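/- Let $\ell,\rho_1,\rho_2,\rho_3,\kappa,b,\delta,\beta,\tau>0$, let all functions be real valued, let $\langle\cdot,\cdot\rangle$, $\|\cdot\|$ be the inner product and norm of $L^2(0,\ell)$, and let $L^2_*(0,\ell)$ and $H^1_*(0,\ell)$ be the subspaces of zero-mean functions of $L^2(0,\ell)$ and $H^1(0,\ell)$; $H^1_0(0,\ell)$ and $H^1_*(0,\ell)$ carry the norm $\|f_x\|$. Put $$\mu(s)=\frac{\beta^2}{\tau^2}e^{-s\beta/\tau}\quad(s>0),\qquad \mathcal M=L^2\big((0,\infty),\mu(s)\,ds;H^1_0(0,\ell)\big),$$ let $T\eta=-D\eta$, where $D$ is the weak derivative in $s$, with domain $\mathcal D(T)=\{\eta\in\mathcal M: D\eta\in\mathcal M,\ \lim_{s\to0}\|\eta_x(s)\|=0\}$, and let $$\mathcal V=H^1_0(0,\ell)\times L^2(0,\ell)\times H^1_*(0,\ell)\times L^2_*(0,\ell)\times L^2(0,\ell),$$ $$\|(\varphi,\tilde\varphi,\psi,\tilde\psi,\theta)\|_{\mathcal V}^2=\kappa\|\varphi_x+\psi\|^2+\rho_1\|\tilde\varphi\|^2+b\|\psi_x\|^2+\rho_2\|\tilde\psi\|^2+\rho_3\|\theta\|^2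 .$$ The Gurtin–Pipkin semigroup $S(t)$ is the strongly continuous semigroup on $\mathcal H=\mathcal V\times\mathcal M$, with norm $\|(u,\eta)\|_{\mathcal H}^2=\|u\|_{\mathcal V}^2+\frac1\beta\|\eta\|_{\mathcal M}^2$, whose infinitesimal generator is $$\mathbb A(\varphi,\tilde\varphi,\psi,\tilde\psi,\theta,\eta)=\Big(\tilde\varphi,\ \tfrac{\kappa}{\rho_1}(\varphi_x+\psi)_x,\ \tilde\psi,\ \tfrac b{\rho_2}\psi_{xx}-\tfrac\kappa{\rho_2}(\varphi_x+\psi)-\tfrac\delta{\rho_2}\theta_x,\ \tfrac1{\beta\rho_3}\Big(\int_0^\infty\mu(s)\eta(s)\,ds\Big)_{xx}-\tfrac\delta{\rho_3}\tilde\psi_x,\ T\eta+\theta\Big)$$ with domain given by $\varphi\in H^2$, $\tilde\varphi\in H^1_0$, $\psi_x\in H^1_0$, $\tilde\psi\in H^1_*$, $\theta\in H^1_0$, $\eta\in\mathcal D(T)$, $\int_0^\infty\mu(s)\eta(s)\,ds\in H^2$. The Timoshenko–Cattaneo semigroup $\hat S(t)$ is the strongly continuous semigroup on $\hat{\mathcal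 H}=\mathcal V\times L^2(0,\ell)$, with norm $\|(u,q)\|_{\hat{\mathcal H}}^2=\|u\|_{\mathcal V}^2+\tau\|q\|^2$, whose infinitesimal generator maps $(\varphi,\tilde\varphi,\psi,\tilde\psi,\theta,q)$ to $$\Big(\tilde\varphi,\ \tfrac{\kappa}{\rho_1}(\varphi_x+\psi)_x,\ \tilde\psi,\ \tfrac b{\rho_2}\psi_{xx}-\tfrac\kappa{\rho_2}(\varphi_x+\psi)-\tfrac\delta{\rho_2}\theta_x,\ -\tfrac1{\rho_3}q_x-\tfrac\delta{\rho_3}\tilde\psi_x,\ -\tfrac\beta\tau q-\tfrac1\tau\theta_x\Big),$$ with domain given by $\varphi\in H^2$, $\tilde\varphi\in H^1_0$, $\psi_x\in H^1_0$, $\tilde\psi\in H^1_*$, $\theta\in H^1_0$, $q\in H^1$. A semigroup $R(t)$ on a normed space $X$ is called exponentially stable if there are $\omega>0$ and $C\ge1$ such that $\|R(t)z\|_X\le Ce^{-\omega t}\|z\|_X$ for all $t\ge0$ and $z\in X$. **Proposition.** If $S(t)$ is exponentially stable on $\mathcal H$, then $\hat S(t)$ is exponentially stable on $\hat{\mathcal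 H}$. -/

import Mathlib

open MeasureTheory Set Filter Topology
open scoped NNReal ENNReal ContDiff

noncomputable section

namespace Timoshenko

/-! ### Lebesgue and Sobolev spaces on `[0, ℓ]` -/

/-- The real Hilbert space `L²(0, ℓ)`. -/
abbrev L2 (ℓ : ℝ) : Type := Lp ℝ 2 (volume.restrict (Icc (0 : ℝ) ℓ))

/-- `g` is the weak derivative of `f` on the open interval `(0, ℓ)`. -/
def HasWeakDeriv {ℓ : ℝ} (f g : L2 ℓ) : Prop :=
  ∀ ζ : ℝ → ℝ, ContDiff ℝ ∞ ζ → HasCompactSupport ζ → tsupport ζ ⊆ Ioo 0 ℓ →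
    ∫ x in Icc 0 ℓ, f x * deriv ζ x = -∫ x in Icc 0 ℓ, g x * ζ x

/-- `f` has a representative that is continuous on `[0, ℓ]` and vanishes at both end points. -/
def VanishesAtEnds {ℓ : ℝ} (f : L2 ℓ) : Prop :=
  ∃ F : ℝ → ℝ, ContinuousOn F (Icc 0 ℓ) ∧ f =ᵐ[volume.restrict (Icc 0 ℓ)] F ∧ F 0 = 0 ∧ F ℓ = 0

/-- `f` has zero mean on `[0, ℓ]`. -/
def ZeroMean {ℓ : ℝ} (f : L2 ℓ) : Prop := ∫ x in Icc 0 ℓ, f x = 0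

variable {ℓ : ℝ}

theorem L2.integrable_mul (f : L2 ℓ) {ζ : ℝ → ℝ} (hζ : Continuous ζ) :
    Integrable (fun x => f x * ζ x) (volume.restrict (Icc 0 ℓ)) := by
  have h1 : Integrable f (volume.restrict (Icc 0 ℓ)) :=
    (Lp.memLp f).integrable (by norm_num)
  obtain ⟨C, hC⟩ := isCompact_Icc.exists_bound_of_continuousOn (s := Icc (0 : ℝ) ℓ) hζ.continuousOn
  refine h1.mul_bdd (c := C) hζ.aestronglyMeasurable ?_
  filter_upwards [ae_restrict_mem measurableSet_Icc] with x hx using hC x hx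

theorem L2.integrable (f : L2 ℓ) : Integrable f (volume.restrict (Icc 0 ℓ)) :=
  (Lp.memLp f).integrable (by norm_num)

theorem L2.intervalIntegrable (h : 0 ≤ ℓ) (f : L2 ℓ) : IntervalIntegrable f volume 0 ℓ := by
  rw [intervalIntegrable_iff_integrableOn_Icc_of_le h]
  exact L2.integrable f

theorem L2.subsingleton (h : ℓ ≤ 0) (f g : L2 ℓ) : f = g := by
  have h0 : volume.restrict (Icc (0 : ℝ) ℓ) = 0 := by
    rw [Measure.restrict_eq_zero, Real.volume_Icc]
    simpa using h
  have h1 : ae (volume.restrict (Icc (0 : ℝ) ℓ)) = ⊥ := by rw [h0, ae_zero]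
  apply Lp.ext
  rw [EventuallyEq, h1]
  exact eventually_bot

theorem HasWeakDeriv.zero : HasWeakDeriv (0 : L2 ℓ) 0 := by
  intro ζ _ _ _
  have h := Lp.coeFn_zero ℝ 2 (volume.restrict (Icc (0 : ℝ) ℓ))
  rw [integral_eq_zero_of_ae, integral_eq_zero_of_ae, neg_zero]
  · filter_upwards [h] with x hx
    rw [hx, Pi.zero_apply, zero_mul]
  · filter_upwards [h] with x hx
    rw [hx, Pi.zero_apply, zero_mul]

theorem HasWeakDeriv.add {f g f' g' : L2 ℓ} (h : HasWeakDeriv f g) (h' : HasWeakDeriv f' g') :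
    HasWeakDeriv (f + f') (g + g') := by
  intro ζ h1 h2 h3
  have hd : Continuous (deriv ζ) := h1.continuous_deriv (by simp)
  have e1 : ∫ x in Icc 0 ℓ, (f + f') x * deriv ζ x
      = ∫ x in Icc 0 ℓ, (f x * deriv ζ x + f' x * deriv ζ x) := by
    apply integral_congr_ae
    filter_upwards [Lp.coeFn_add f f'] with x hx
    rw [hx, Pi.add_apply, add_mul]
  have e2 : ∫ x in Icc 0 ℓ, (g + g') x * ζ x
      = ∫ x in Icc 0 ℓ, (g x * ζ x + g' x * ζ x) := by
    apply integral_congr_ae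
    filter_upwards [Lp.coeFn_add g g'] with x hx
    rw [hx, Pi.add_apply, add_mul]
  rw [e1, e2, integral_add (L2.integrable_mul _ hd) (L2.integrable_mul _ hd),
    integral_add (L2.integrable_mul _ h1.continuous) (L2.integrable_mul _ h1.continuous),
    h ζ h1 h2 h3, h' ζ h1 h2 h3]
  ring

theorem HasWeakDeriv.smul {f g : L2 ℓ} (c : ℝ) (h : HasWeakDeriv f g) :
    HasWeakDeriv (c • f) (c • g) := by
  intro ζ h1 h2 h3
  have e1 : ∫ x in Icc 0 ℓ, (c • f) x * deriv ζ x = ∫ x in Icc 0 ℓ, c * (f x * deriv ζ x) := by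
    apply integral_congr_ae
    filter_upwards [Lp.coeFn_smul c f] with x hx
    rw [hx, Pi.smul_apply, smul_eq_mul, mul_assoc]
  have e2 : ∫ x in Icc 0 ℓ, (c • g) x * ζ x = ∫ x in Icc 0 ℓ, c * (g x * ζ x) := by
    apply integral_congr_ae
    filter_upwards [Lp.coeFn_smul c g] with x hx
    rw [hx, Pi.smul_apply, smul_eq_mul, mul_assoc]
  rw [e1, e2, integral_const_mul, integral_const_mul, h ζ h1 h2 h3]
  ring

theorem VanishesAtEnds.zero : VanishesAtEnds (0 : L2 ℓ) :=
  ⟨0, continuousOn_const, Lp.coeFn_zero _ _ _, rfl, rfl⟩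

theorem VanishesAtEnds.add {f g : L2 ℓ} : VanishesAtEnds f → VanishesAtEnds g →
    VanishesAtEnds (f + g) := by
  rintro ⟨F, h1, h2, h3, h4⟩ ⟨G, k1, k2, k3, k4⟩
  exact ⟨F + G, h1.add k1, (Lp.coeFn_add f g).trans (h2.add k2), by simp [h3, k3],
    by simp [h4, k4]⟩

theorem VanishesAtEnds.smul {f : L2 ℓ} (c : ℝ) : VanishesAtEnds f → VanishesAtEnds (c • f) := by
  rintro ⟨F, h1, h2, h3, h4⟩
  exact ⟨c • F, h1.const_smul c, (Lp.coeFn_smul c f).trans (h2.const_smul c), by simp [h3],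
    by simp [h4]⟩

theorem ZeroMean.zero : ZeroMean (0 : L2 ℓ) := by
  rw [ZeroMean, integral_eq_zero_of_ae (Lp.coeFn_zero _ _ _)]

theorem ZeroMean.add {f g : L2 ℓ} (hf : ZeroMean f) (hg : ZeroMean g) : ZeroMean (f + g) := by
  rw [ZeroMean, integral_congr_ae (Lp.coeFn_add f g)]
  simp only [Pi.add_apply]
  rw [integral_add (L2.integrable f) (L2.integrable g), hf, hg, add_zero]

theorem ZeroMean.smul {f : L2 ℓ} (c : ℝ) (hf : ZeroMean f) : ZeroMean (c • f) := by
  rw [ZeroMean, integral_congr_ae (Lp.coeFn_smul c f)]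
  simp only [Pi.smul_apply, smul_eq_mul]
  rw [integral_const_mul, hf, mul_zero]

/-- A function with vanishing weak derivative is constant. -/
theorem HasWeakDeriv.ae_const {f : L2 ℓ} (h : HasWeakDeriv f 0) :
    ∃ c : ℝ, f =ᵐ[volume.restrict (Icc 0 ℓ)] fun _ => c := by
  rcases le_or_gt ℓ 0 with hl | hl
  · refine ⟨0, ?_⟩
    rw [L2.subsingleton hl f 0]
    exact Lp.coeFn_zero _ _ _
  have h0 : ∀ ζ : ℝ → ℝ, ContDiff ℝ ∞ ζ → HasCompactSupport ζ → tsupport ζ ⊆ Ioo 0 ℓ →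
      ∫ x in Icc 0 ℓ, f x * deriv ζ x = 0 := by
    intro ζ h1 h2 h3
    rw [h ζ h1 h2 h3, integral_eq_zero_of_ae, neg_zero]
    filter_upwards [Lp.coeFn_zero ℝ 2 (volume.restrict (Icc (0 : ℝ) ℓ))] with x hx
    rw [hx, Pi.zero_apply, zero_mul]
  -- a test function of integral one
  obtain ⟨θ, hθ1, hθ2, hθ3, hθ4⟩ : ∃ θ : ℝ → ℝ, ContDiff ℝ ∞ θ ∧ HasCompactSupport θ ∧
      tsupport θ ⊆ Ioo 0 ℓ ∧ ∫ x, θ x = 1 := by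
    have hm : Ioo 0 ℓ ∈ 𝓝 (ℓ / 2) := Ioo_mem_nhds (by linarith) (by linarith)
    obtain ⟨u, hu1, hu2, hu3, hu4, hu5⟩ := exists_contDiff_tsupport_subset (n := ⊤) hm
    have hpos : 0 < ∫ x, u x := by
      apply hu3.continuous.integral_pos_of_hasCompactSupport_nonneg_nonzero hu2
      · intro x
        exact (hu4 (mem_range_self x)).1
      · rw [hu5]
        norm_num
    refine ⟨fun x => (∫ y, u y)⁻¹ * u x, contDiff_const.mul hu3, hu2.mul_left, ?_, ?_⟩
    · exact (tsupport_mul_subset_right).trans hu1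
    · rw [integral_const_mul, inv_mul_cancel₀ hpos.ne']
  set c := ∫ x in Icc 0 ℓ, f x * θ x with hc
  refine ⟨c, ?_⟩
  -- primitives of test functions with zero integral are test functions
  have key : ∀ k : ℝ → ℝ, ContDiff ℝ ∞ k → HasCompactSupport k → tsupport k ⊆ Ioo 0 ℓ →
      ∫ x, k x = 0 → ∫ x in Icc 0 ℓ, f x * k x = 0 := by
    intro k k1 k2 k3 k4
    have kd : ∀ x, HasDerivAt (fun y => ∫ t in (0 : ℝ)..y, k t) (k x) x := fun x =>
      k1.continuous.integral_hasStrictDerivAt 0 x |>.hasDerivAt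
    have kd' : deriv (fun y => ∫ t in (0 : ℝ)..y, k t) = k := funext fun x => (kd x).deriv
    have hsupp : Function.support k ⊆ Ioo 0 ℓ := (subset_tsupport k).trans k3
    have hfull : ∫ t in (0 : ℝ)..ℓ, k t = 0 := by
      rw [intervalIntegral.integral_eq_integral_of_support_subset
        (hsupp.trans Ioo_subset_Ioc_self), k4]
    have hK : ∃ a b : ℝ, 0 < a ∧ b < ℓ ∧ tsupport k ⊆ Icc a b := by
      rcases (tsupport k).eq_empty_or_nonempty with he | hne
      · exact ⟨1, ℓ - 1, by norm_num, by linarith, by simp [he]⟩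
      · obtain ⟨a, ha, ha'⟩ := k2.isCompact.exists_isLeast hne
        obtain ⟨b, hb, hb'⟩ := k2.isCompact.exists_isGreatest hne
        exact ⟨a, b, (k3 ha).1, (k3 hb).2, fun x hx => ⟨ha' hx, hb' hx⟩⟩
    obtain ⟨a, b, ha, hb, hab⟩ := hK
    have hz : ∀ x, x ∉ Icc a b → k x = 0 := fun x hx => by
      by_contra hne
      exact hx (hab (subset_tsupport k hne))
    have hs : Function.support (fun y => ∫ t in (0 : ℝ)..y, k t) ⊆ Icc a b := by
      intro y hy
      by_contra hny
      apply hy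
      rw [mem_Icc, not_and_or, not_le, not_le] at hny
      rcases hny with hya | hyb
      · apply intervalIntegral.integral_zero_ae
        refine Eventually.of_forall fun t ht => hz t fun hh => ?_
        have := (mem_uIoc.mp ht)
        rcases this with ⟨_, h2⟩ | ⟨_, h2⟩
        · linarith [hh.1]
        · linarith [hh.1]
      · have : ∫ t in (0 : ℝ)..y, k t = (∫ t in (0 : ℝ)..ℓ, k t) - ∫ t in y..ℓ, k t := by
          rw [eq_sub_iff_add_eq]
          exact intervalIntegral.integral_add_adjacent_intervals
            (k1.continuous.intervalIntegrable _ _) (k1.continuous.intervalIntegrable _ _)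
        simp only
        rw [this, hfull, zero_sub, neg_eq_zero]
        apply intervalIntegral.integral_zero_ae
        refine Eventually.of_forall fun t ht => hz t fun hh => ?_
        rcases mem_uIoc.mp ht with ⟨h2, _⟩ | ⟨h2, _⟩
        · linarith [hh.2]
        · linarith [hh.2]
    have hts : tsupport (fun y => ∫ t in (0 : ℝ)..y, k t) ⊆ Icc a b :=
      closure_minimal hs isClosed_Icc
    have := h0 (fun y => ∫ t in (0 : ℝ)..y, k t) ?_ ?_ ?_
    · rwa [kd'] at this
    · rw [contDiff_infty_iff_deriv]
      exact ⟨fun x => (kd x).differentiableAt, kd'.symm ▸ k1⟩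
    · exact HasCompactSupport.of_support_subset_isCompact isCompact_Icc hs
    · exact hts.trans fun x hx => ⟨ha.trans_le hx.1, hx.2.trans_lt hb⟩
  have hloc : LocallyIntegrableOn (fun x => f x - c) (Ioo 0 ℓ) volume := by
    apply IntegrableOn.locallyIntegrableOn
    apply IntegrableOn.mono_set (t := Icc 0 ℓ) _ Ioo_subset_Icc_self
    exact (L2.integrable f).sub (integrable_const c)
  have hfin := isOpen_Ioo.ae_eq_zero_of_integral_contDiff_smul_eq_zero hloc (by
    intro g g1 g2 g3
    have gs : Function.support g ⊆ Icc 0 ℓ :=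
      ((subset_tsupport g).trans g3).trans Ioo_subset_Icc_self
    have e1 : ∫ x, g x • (f x - c) = ∫ x in Icc 0 ℓ, g x • (f x - c) := by
      symm
      apply setIntegral_eq_integral_of_forall_compl_eq_zero
      intro x hx
      have : g x = 0 := by
        by_contra hne
        exact hx (gs hne)
      simp [this]
    have eg : ∫ x in Icc 0 ℓ, g x = ∫ x, g x := by
      apply setIntegral_eq_integral_of_forall_compl_eq_zero
      intro x hx
      by_contra hne
      exact hx (gs hne)
    have hgi : Integrable g := g1.continuous.integrable_of_hasCompactSupport g2
    have hθi : Integrable θ := hθ1.continuous.integrable_of_hasCompactSupport hθ2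
    have hk := key (fun x => g x - (∫ y, g y) * θ x) (g1.sub (contDiff_const.mul hθ1))
      (g2.sub hθ2.mul_left)
      ((tsupport_sub g _).trans (union_subset g3 (tsupport_mul_subset_right.trans hθ3)))
      (by rw [integral_sub hgi (hθi.const_mul _), integral_const_mul, hθ4]; ring)
    have e2 : ∫ x in Icc 0 ℓ, f x * (g x - (∫ y, g y) * θ x)
        = (∫ x in Icc 0 ℓ, f x * g x) - (∫ y, g y) * c := by
      rw [hc, ← integral_const_mul, ← integral_sub (L2.integrable_mul f g1.continuous)
        ((L2.integrable_mul f hθ1.continuous).const_mul _)]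
      congr 1
      ext x
      ring
    rw [e2] at hk
    rw [e1]
    have e3 : ∫ x in Icc 0 ℓ, g x • (f x - c)
        = (∫ x in Icc 0 ℓ, f x * g x) - ∫ x in Icc 0 ℓ, c * g x := by
      rw [← integral_sub (L2.integrable_mul f g1.continuous) (hgi.restrict.const_mul _)]
      congr 1
      ext x
      simp only [smul_eq_mul]
      ring
    rw [e3, integral_const_mul, eg]
    linarith)
  rw [EventuallyEq, ae_restrict_iff' measurableSet_Icc]
  filter_upwards [hfin, (Ioo_ae_eq_Icc (a := (0 : ℝ)) (b := ℓ) (μ := volume)).mem_iff]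
    with x hx hx' hx''
  exact sub_eq_zero.mp (hx (hx'.mpr hx''))

/-- Every square summable function is the weak derivative of its primitive. -/
theorem exists_primitive (hl : 0 ≤ ℓ) (g : L2 ℓ) : ∃ f : L2 ℓ, HasWeakDeriv f g ∧
    f =ᵐ[volume.restrict (Icc 0 ℓ)] (fun x => ∫ t in (0 : ℝ)..x, g t) ∧
    ContinuousOn (fun x => ∫ t in (0 : ℝ)..x, g t) (Icc 0 ℓ) := by
  have hac := (L2.intervalIntegrable hl g).absolutelyContinuousOnInterval_intervalIntegral
    (c := 0) (by simp)
  have hcont : ContinuousOn (fun x => ∫ t in (0 : ℝ)..x, g t) (Icc 0 ℓ) := by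
    have := hac.continuousOn
    rwa [uIcc_of_le hl] at this
  have hmem : MemLp (fun x => ∫ t in (0 : ℝ)..x, g t) 2 (volume.restrict (Icc 0 ℓ)) := by
    obtain ⟨C, hC⟩ := isCompact_Icc.exists_bound_of_continuousOn hcont
    apply MemLp.of_bound (hcont.aestronglyMeasurable measurableSet_Icc) C
    filter_upwards [ae_restrict_mem measurableSet_Icc] with x hx using hC x hx
  refine ⟨hmem.toLp _, ?_, hmem.coeFn_toLp, hcont⟩
  intro ζ h1 h2 h3
  have hζ : AbsolutelyContinuousOnInterval ζ 0 ℓ :=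
    (h1.contDiffOn.of_le (by simp)).absolutelyContinuousOnInterval
  have ibp := hac.integral_mul_deriv_eq_deriv_mul hζ
  have hz : ζ ℓ = 0 := by
    by_contra hne
    exact lt_irrefl _ (h3 (subset_tsupport ζ hne)).2
  have e1 : ∫ x in Icc 0 ℓ, (hmem.toLp _) x * deriv ζ x
      = ∫ x in (0 : ℝ)..ℓ, (∫ t in (0 : ℝ)..x, g t) * deriv ζ x := by
    rw [intervalIntegral.integral_of_le hl, ← integral_Icc_eq_integral_Ioc]
    apply integral_congr_ae
    filter_upwards [hmem.coeFn_toLp] with x hx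
    rw [hx]
  have e2 : ∫ x in Icc 0 ℓ, g x * ζ x
      = ∫ x in (0 : ℝ)..ℓ, deriv (fun x => ∫ t in (0 : ℝ)..x, g t) x * ζ x := by
    rw [integral_Icc_eq_integral_Ioc, ← intervalIntegral.integral_of_le hl]
    apply intervalIntegral.integral_congr_ae
    filter_upwards [(L2.intervalIntegrable hl g).ae_hasDerivAt_integral] with x hx hx'
    rw [(hx (uIoc_subset_uIcc hx') 0 (by simp)).deriv]
  rw [e1, e2, ibp, hz]
  simp

/-- An `H¹` function vanishing at the end points is the primitive of its weak derivative, which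
has zero mean. -/
theorem HasWeakDeriv.eq_primitive (hl : 0 < ℓ) {f g : L2 ℓ} (h : HasWeakDeriv f g)
    (h0 : VanishesAtEnds f) :
    f =ᵐ[volume.restrict (Icc 0 ℓ)] (fun x => ∫ t in (0 : ℝ)..x, g t) ∧ ZeroMean g := by
  obtain ⟨p, hp, hpe, hpc⟩ := exists_primitive hl.le g
  obtain ⟨F, hF1, hF2, hF3, hF4⟩ := h0
  have hd : HasWeakDeriv (f + (-1 : ℝ) • p) 0 := by
    have := h.add (hp.smul (-1))
    simpa using this
  obtain ⟨c, hc⟩ := hd.ae_const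
  have hFe : F =ᵐ[volume.restrict (Icc 0 ℓ)] fun x => c + ∫ t in (0 : ℝ)..x, g t := by
    filter_upwards [hF2, hpe, hc, Lp.coeFn_add f ((-1 : ℝ) • p), Lp.coeFn_smul (-1 : ℝ) p]
      with x a1 a2 a3 a4 a5
    rw [a4, Pi.add_apply, a5, Pi.smul_apply, a1, a2, smul_eq_mul] at a3
    linarith
  have hall := Measure.eqOn_Icc_of_ae_eq volume hl.ne hFe hF1 (continuousOn_const.add hpc)
  have hc0 : c = 0 := by
    have := hall (left_mem_Icc.mpr hl.le)
    simp only [hF3, intervalIntegral.integral_same] at this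
    linarith
  constructor
  · filter_upwards [hF2, hFe] with x a1 a2
    rw [a1, a2, hc0, zero_add]
  · have := hall (right_mem_Icc.mpr hl.le)
    simp only [hF4, hc0, zero_add] at this
    rw [ZeroMean, integral_Icc_eq_integral_Ioc, ← intervalIntegral.integral_of_le hl.le, ← this]

/-- The pairs `(f, f_x)` with `f ∈ H₀¹(0, ℓ)`. -/
def H10Sub (ℓ : ℝ) : Submodule ℝ (L2 ℓ × L2 ℓ) where
  carrier := {p | HasWeakDeriv p.1 p.2 ∧ VanishesAtEnds p.1}
  add_mem' h h' := ⟨h.1.add h'.1, h.2.add h'.2⟩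
  zero_mem' := ⟨HasWeakDeriv.zero, VanishesAtEnds.zero⟩
  smul_mem' c _ h := ⟨h.1.smul c, h.2.smul c⟩

/-- The pairs `(f, f_x)` with `f ∈ H¹(0, ℓ)` of zero mean. -/
def H1sSub (ℓ : ℝ) : Submodule ℝ (L2 ℓ × L2 ℓ) where
  carrier := {p | HasWeakDeriv p.1 p.2 ∧ ZeroMean p.1}
  add_mem' h h' := ⟨h.1.add h'.1, h.2.add h'.2⟩
  zero_mem' := ⟨HasWeakDeriv.zero, ZeroMean.zero⟩
  smul_mem' c _ h := ⟨h.1.smul c, h.2.smul c⟩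

/-- The space `L²_*(0, ℓ)` of square summable functions of zero mean, with the `L²` norm. -/
def L2s (ℓ : ℝ) : Submodule ℝ (L2 ℓ) where
  carrier := {f | ZeroMean f}
  add_mem' h h' := h.add h'
  zero_mem' := ZeroMean.zero
  smul_mem' c _ h := h.smul c

/-- The space `H₀¹(0, ℓ)`; an element is stored together with its (unique) weak derivative. It is
normed below by the `L²` norm of the derivative. -/
def H10 (ℓ : ℝ) : Type := H10Sub ℓ

/-- The space `H¹_*(0, ℓ)` of `H¹` functions of zero mean; an element is stored together with its
(unique) weak derivative. It is normed below by the `L²` norm of the derivative. -/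
def H1s (ℓ : ℝ) : Type := H1sSub ℓ

instance : AddCommGroup (H10 ℓ) := inferInstanceAs (AddCommGroup (H10Sub ℓ))
instance : Module ℝ (H10 ℓ) := inferInstanceAs (Module ℝ (H10Sub ℓ))
instance : AddCommGroup (H1s ℓ) := inferInstanceAs (AddCommGroup (H1sSub ℓ))
instance : Module ℝ (H1s ℓ) := inferInstanceAs (Module ℝ (H1sSub ℓ))

/-- The underlying `L²` function of an element of `H₀¹`. -/
def H10.val : H10 ℓ →ₗ[ℝ] L2 ℓ := (LinearMap.fst ℝ (L2 ℓ) (L2 ℓ)).comp (H10Sub ℓ).subtype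

/-- The derivative `f_x` of an element of `H₀¹`. -/
def H10.grad : H10 ℓ →ₗ[ℝ] L2 ℓ := (LinearMap.snd ℝ (L2 ℓ) (L2 ℓ)).comp (H10Sub ℓ).subtype

/-- The underlying `L²` function of an element of `H¹_*`. -/
def H1s.val : H1s ℓ →ₗ[ℝ] L2 ℓ := (LinearMap.fst ℝ (L2 ℓ) (L2 ℓ)).comp (H1sSub ℓ).subtype

/-- The derivative `f_x` of an element of `H¹_*`. -/
def H1s.grad : H1s ℓ →ₗ[ℝ] L2 ℓ := (LinearMap.snd ℝ (L2 ℓ) (L2 ℓ)).comp (H1sSub ℓ).subtype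

theorem H10.hasWeakDeriv (f : H10 ℓ) : HasWeakDeriv f.val f.grad := f.2.1
theorem H10.vanishesAtEnds (f : H10 ℓ) : VanishesAtEnds f.val := f.2.2
theorem H1s.hasWeakDeriv (f : H1s ℓ) : HasWeakDeriv f.val f.grad := f.2.1
theorem H1s.zeroMean (f : H1s ℓ) : ZeroMean f.val := f.2.2

theorem H10.grad_injective : Function.Injective (H10.grad (ℓ := ℓ)) := by
  refine (injective_iff_map_eq_zero _).mpr fun f hf => ?_
  rcases le_or_gt ℓ 0 with hl | hl
  · exact Subtype.ext (Prod.ext (L2.subsingleton hl _ _) (L2.subsingleton hl _ _))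
  have hw := f.hasWeakDeriv
  rw [hf] at hw
  have h1 := (hw.eq_primitive hl f.vanishesAtEnds).1
  have h2 : f.val = 0 := by
    apply Lp.ext
    filter_upwards [h1, Lp.coeFn_zero ℝ 2 (volume.restrict (Icc (0 : ℝ) ℓ)),
      ae_restrict_mem measurableSet_Icc] with x a1 a2 a3
    rw [a1, a2]
    apply intervalIntegral.integral_zero_ae
    have := Lp.coeFn_zero ℝ 2 (volume.restrict (Icc (0 : ℝ) ℓ))
    rw [EventuallyEq, ae_restrict_iff' measurableSet_Icc] at this
    filter_upwards [this] with t ht ht'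
    rw [uIoc_of_le a3.1] at ht'
    simpa using ht ⟨ht'.1.le, ht'.2.trans a3.2⟩
  exact Subtype.ext (Prod.ext h2 hf)

theorem H1s.grad_injective : Function.Injective (H1s.grad (ℓ := ℓ)) := by
  refine (injective_iff_map_eq_zero _).mpr fun f hf => ?_
  rcases le_or_gt ℓ 0 with hl | hl
  · exact Subtype.ext (Prod.ext (L2.subsingleton hl _ _) (L2.subsingleton hl _ _))
  have hw := f.hasWeakDeriv
  rw [hf] at hw
  obtain ⟨c, hc⟩ := hw.ae_const
  have hm := f.zeroMean
  rw [ZeroMean, integral_congr_ae hc, integral_const] at hm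
  have hv : (volume.restrict (Icc (0 : ℝ) ℓ)).real univ = ℓ := by
    simp [Measure.real, hl.le]
  rw [hv, smul_eq_mul] at hm
  have hc0 : c = 0 := by
    rcases mul_eq_zero.mp hm with h | h
    · exact absurd h hl.ne'
    · exact h
  have h2 : f.val = 0 := by
    apply Lp.ext
    filter_upwards [hc, Lp.coeFn_zero ℝ 2 (volume.restrict (Icc (0 : ℝ) ℓ))] with x a1 a2
    rw [a1, a2, hc0, Pi.zero_apply]
  exact Subtype.ext (Prod.ext h2 hf)

instance : NormedAddCommGroup (H10 ℓ) :=
  NormedAddCommGroup.induced (H10 ℓ) (L2 ℓ) H10.grad H10.grad_injective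
instance : NormedSpace ℝ (H10 ℓ) := NormedSpace.induced ℝ (H10 ℓ) (L2 ℓ) H10.grad
instance : NormedAddCommGroup (H1s ℓ) :=
  NormedAddCommGroup.induced (H1s ℓ) (L2 ℓ) H1s.grad H1s.grad_injective
instance : NormedSpace ℝ (H1s ℓ) := NormedSpace.induced ℝ (H1s ℓ) (L2 ℓ) H1s.grad

theorem H10.norm_eq (f : H10 ℓ) : ‖f‖ = ‖f.grad‖ := rfl
theorem H1s.norm_eq (f : H1s ℓ) : ‖f‖ = ‖f.grad‖ := rfl

/-- `H₀¹` is complete, so that Bochner integrals of `H₀¹`-valued functions are meaningful. -/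
instance : CompleteSpace (H10 ℓ) := by
  rcases le_or_gt ℓ 0 with hl | hl
  · have : Subsingleton (H10 ℓ) :=
      ⟨fun f g => H10.grad_injective (L2.subsingleton hl _ _)⟩
    infer_instance
  apply Metric.complete_of_cauchySeq_tendsto
  intro u hu
  have hiso : Isometry (H10.grad (ℓ := ℓ)) := AddMonoidHomClass.isometry_of_norm _ fun _ => rfl
  obtain ⟨g, hg⟩ := cauchySeq_tendsto_of_complete
    (u := fun n => H10.grad (u n)) (hu.map hiso.uniformContinuous)
  have hmean : ZeroMean g := by
    have hz : ∀ n, ZeroMean (H10.grad (u n)) := fun n =>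
      ((u n).hasWeakDeriv.eq_primitive hl (u n).vanishesAtEnds).2
    let one : L2 ℓ := (memLp_const (1 : ℝ)).toLp (fun _ => (1 : ℝ))
    have hin : ∀ f : L2 ℓ, inner ℝ one f = ∫ x in Icc 0 ℓ, f x := by
      intro f
      rw [L2.inner_def]
      apply integral_congr_ae
      filter_upwards [(memLp_const (1 : ℝ) (p := 2)
        (μ := volume.restrict (Icc (0 : ℝ) ℓ))).coeFn_toLp] with x hx
      change f x * one x = f x
      rw [hx, mul_one]
    have ht : Tendsto (fun n => inner ℝ one (H10.grad (u n))) atTop (𝓝 (inner ℝ one g)) :=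
      tendsto_const_nhds.inner hg
    have h0 : (fun n => inner ℝ one (H10.grad (u n))) = fun _ => (0 : ℝ) := by
      ext n
      rw [hin, hz n]
    rw [h0] at ht
    rw [ZeroMean, ← hin]
    exact (tendsto_nhds_unique ht tendsto_const_nhds)
  obtain ⟨p, hp, hpe, hpc⟩ := exists_primitive hl.le g
  have hend : ∫ t in (0 : ℝ)..ℓ, g t = 0 := by
    rw [intervalIntegral.integral_of_le hl.le, ← integral_Icc_eq_integral_Ioc]
    exact hmean
  let f : H10 ℓ := ⟨(p, g), hp, _, hpc, hpe, by simp, hend⟩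
  refine ⟨f, ?_⟩
  rw [hiso.isEmbedding.tendsto_nhds_iff]
  exact hg

/-! ### Parameters, memory kernel and memory space -/

/-- The length of the beam, the constants of the Timoshenko system, the constant of the
heat conduction law and the relaxation parameter of the Cattaneo law; all strictly positive. -/
structure Params where
  ℓ : ℝ
  ρ₁ : ℝ
  ρ₂ : ℝ
  ρ₃ : ℝ
  κ : ℝ
  b : ℝ
  δ : ℝ
  β : ℝ
  τ : ℝ
  ℓ_pos : 0 < ℓ
  ρ₁_pos : 0 < ρ₁
  ρ₂_pos : 0 < ρ₂
  ρ₃_pos : 0 < ρ₃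
  κ_pos : 0 < κ
  b_pos : 0 < b
  δ_pos : 0 < δ
  β_pos : 0 < β
  τ_pos : 0 < τ

/-- The kernel `μ(s) = (β²/τ²) exp(-sβ/τ)`. -/
def Params.μ (P : Params) (s : ℝ) : ℝ := P.β ^ 2 / P.τ ^ 2 * Real.exp (-(s * P.β / P.τ))

/-- The measure `μ(s) ds` on `(0, ∞)`. -/
def Params.μds (P : Params) : Measure ℝ :=
  (volume.restrict (Ioi 0)).withDensity fun s => ENNReal.ofReal (P.μ s)

/-- The memory space `M = L²(ℝ⁺, μ(s) ds; H₀¹)`. -/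
abbrev Memory (P : Params) : Type := Lp (H10 P.ℓ) 2 P.μds

/-- `ξ` is the weak derivative of `η` with respect to `s ∈ (0, ∞)`. -/
def HasWeakDerivS {P : Params} (η ξ : Memory P) : Prop :=
  ∀ ζ : ℝ → ℝ, ContDiff ℝ ∞ ζ → HasCompactSupport ζ → tsupport ζ ⊆ Ioi 0 →
    ∫ s in Ioi (0 : ℝ), deriv ζ s • η s = -∫ s in Ioi (0 : ℝ), ζ s • ξ s

/-- `lim_{s → 0} η(s) = 0` in `H₀¹`, for the representative of `η` continuous on `(0, ∞)`. -/
def VanishesAtZero {P : Params} (η : Memory P) : Prop :=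
  ∃ F : ℝ → H10 P.ℓ, ContinuousOn F (Ioi 0) ∧ η =ᵐ[P.μds] F ∧ Tendsto F (𝓝[>] 0) (𝓝 0)

/-- The graph of `T = -D`, the generator of the right translations on `M`: `η` belongs to the
domain of `T`, and `T η = ξ`. -/
def MemoryGenerator {P : Params} (η ξ : Memory P) : Prop :=
  HasWeakDerivS η (-ξ) ∧ VanishesAtZero η

/-! ### The phase spaces -/

/-- The space of the components `(φ, φ̃, ψ, ψ̃, θ)` common to the two systems, namely
`H₀¹ × L² × H¹_* × L²_* × L²`. -/
def Mech (P : Params) : Type := H10 P.ℓ × L2 P.ℓ × H1s P.ℓ × L2s P.ℓ × L2 P.ℓ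

instance (P : Params) : AddCommGroup (Mech P) :=
  inferInstanceAs (AddCommGroup (H10 P.ℓ × L2 P.ℓ × H1s P.ℓ × L2s P.ℓ × L2 P.ℓ))
instance (P : Params) : Module ℝ (Mech P) :=
  inferInstanceAs (Module ℝ (H10 P.ℓ × L2 P.ℓ × H1s P.ℓ × L2s P.ℓ × L2 P.ℓ))

namespace Mech

variable {P : Params}

/-- The displacement `φ`. -/
def φ (u : Mech P) : H10 P.ℓ := u.1
/-- The velocity `φ̃`. -/
def φt (u : Mech P) : L2 P.ℓ := u.2.1
/-- The rotation angle `ψ`. -/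
def ψ (u : Mech P) : H1s P.ℓ := u.2.2.1
/-- The velocity `ψ̃`. -/
def ψt (u : Mech P) : L2s P.ℓ := u.2.2.2.1
/-- The temperature `θ`. -/
def θ (u : Mech P) : L2 P.ℓ := u.2.2.2.2

/-- The linear map `(√κ (φ_x + ψ), √ρ₁ φ̃, √b ψ_x, √ρ₂ ψ̃, √ρ₃ θ)` that defines the norm. -/
def energyMap (P : Params) : Mech P →ₗ[ℝ]
    WithLp 2 (L2 P.ℓ × WithLp 2 (L2 P.ℓ × WithLp 2 (L2 P.ℓ × WithLp 2 (L2 P.ℓ × L2 P.ℓ)))) where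
  toFun u := WithLp.toLp 2 (√P.κ • (u.φ.grad + u.ψ.val), WithLp.toLp 2 (√P.ρ₁ • u.φt,
    WithLp.toLp 2 (√P.b • u.ψ.grad, WithLp.toLp 2 (√P.ρ₂ • (u.ψt : L2 P.ℓ), √P.ρ₃ • u.θ))))
  map_add' u v := by
    have h1 : (u + v).φ = u.φ + v.φ := rfl
    have h2 : (u + v).φt = u.φt + v.φt := rfl
    have h3 : (u + v).ψ = u.ψ + v.ψ := rfl
    have h4 : (u + v).ψt = u.ψt + v.ψt := rfl
    have h5 : (u + v).θ = u.θ + v.θ := rfl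
    rw [h1, h2, h3, h4, h5]
    simp only [map_add, Submodule.coe_add, smul_add, ← WithLp.toLp_add, Prod.mk_add_mk]
    rw [add_add_add_comm]
  map_smul' c u := by
    have h1 : (c • u).φ = c • u.φ := rfl
    have h2 : (c • u).φt = c • u.φt := rfl
    have h3 : (c • u).ψ = c • u.ψ := rfl
    have h4 : (c • u).ψt = c • u.ψt := rfl
    have h5 : (c • u).θ = c • u.θ := rfl
    rw [h1, h2, h3, h4, h5]
    simp only [map_smul, Submodule.coe_smul, RingHom.id_apply, ← smul_add, ← WithLp.toLp_smul,
      Prod.smul_mk, smul_comm _ c]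

theorem energyMap_injective (P : Params) : Function.Injective (energyMap P) := by
  refine (injective_iff_map_eq_zero _).mpr fun u hu => ?_
  have k1 := (Real.sqrt_pos.mpr P.κ_pos).ne'
  have k2 := (Real.sqrt_pos.mpr P.ρ₁_pos).ne'
  have k3 := (Real.sqrt_pos.mpr P.b_pos).ne'
  have k4 := (Real.sqrt_pos.mpr P.ρ₂_pos).ne'
  have k5 := (Real.sqrt_pos.mpr P.ρ₃_pos).ne'
  have e1 : √P.κ • (u.φ.grad + u.ψ.val) = 0 := congrArg (fun w => w.fst) hu
  have e2 : √P.ρ₁ • u.φt = 0 := congrArg (fun w => w.snd.fst) hu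
  have e3 : √P.b • u.ψ.grad = 0 := congrArg (fun w => w.snd.snd.fst) hu
  have e4 : √P.ρ₂ • (u.ψt : L2 P.ℓ) = 0 := congrArg (fun w => w.snd.snd.snd.fst) hu
  have e5 : √P.ρ₃ • u.θ = 0 := congrArg (fun w => w.snd.snd.snd.snd) hu
  have f3 : u.ψ = 0 := by
    apply H1s.grad_injective
    rw [map_zero]
    exact (smul_eq_zero.mp e3).resolve_left k3
  have f1 : u.φ = 0 := by
    apply H10.grad_injective
    have := (smul_eq_zero.mp e1).resolve_left k1
    rwa [f3, map_zero, add_zero] at this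
  have f2 : u.φt = 0 := (smul_eq_zero.mp e2).resolve_left k2
  have f4 : u.ψt = 0 := Subtype.ext ((smul_eq_zero.mp e4).resolve_left k4)
  have f5 : u.θ = 0 := (smul_eq_zero.mp e5).resolve_left k5
  exact Prod.ext f1 (Prod.ext f2 (Prod.ext f3 (Prod.ext f4 f5)))

instance (P : Params) : NormedAddCommGroup (Mech P) :=
  NormedAddCommGroup.induced (Mech P) _ (energyMap P) (energyMap_injective P)
instance (P : Params) : NormedSpace ℝ (Mech P) := NormedSpace.induced ℝ (Mech P) _ (energyMap P)

theorem norm_sq (u : Mech P) : ‖u‖ ^ 2 = P.κ * ‖u.φ.grad + u.ψ.val‖ ^ 2 + P.ρ₁ * ‖u.φt‖ ^ 2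
    + P.b * ‖u.ψ.grad‖ ^ 2 + P.ρ₂ * ‖u.ψt‖ ^ 2 + P.ρ₃ * ‖u.θ‖ ^ 2 := by
  have h : ‖u‖ = ‖energyMap P u‖ := rfl
  rw [h]
  simp only [WithLp.prod_norm_sq_eq_of_L2]
  change ‖√P.κ • (u.φ.grad + u.ψ.val)‖ ^ 2 + (‖√P.ρ₁ • u.φt‖ ^ 2 + (‖√P.b • u.ψ.grad‖ ^ 2 +
    (‖√P.ρ₂ • (u.ψt : L2 P.ℓ)‖ ^ 2 + ‖√P.ρ₃ • u.θ‖ ^ 2))) = _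
  simp only [norm_smul,
    mul_pow, Real.norm_eq_abs, sq_abs, Real.sq_sqrt P.κ_pos.le, Real.sq_sqrt P.ρ₁_pos.le,
    Real.sq_sqrt P.b_pos.le, Real.sq_sqrt P.ρ₂_pos.le, Real.sq_sqrt P.ρ₃_pos.le,
    Submodule.coe_norm]
  ring

end Mech

/-- The phase space `H` of the Timoshenko-Gurtin-Pipkin system; `z.1` holds the first five
components and `z.2` is the memory variable `η`. -/
def GPSpace (P : Params) : Type := Mech P × Memory P

/-- The phase space `Ĥ` of the Timoshenko-Cattaneo system; `z.1` holds the first five components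
and `z.2` is the heat flux `q`. -/
def TCSpace (P : Params) : Type := Mech P × L2 P.ℓ

instance (P : Params) : AddCommGroup (GPSpace P) :=
  inferInstanceAs (AddCommGroup (Mech P × Memory P))
instance (P : Params) : Module ℝ (GPSpace P) := inferInstanceAs (Module ℝ (Mech P × Memory P))
instance (P : Params) : AddCommGroup (TCSpace P) :=
  inferInstanceAs (AddCommGroup (Mech P × L2 P.ℓ))
instance (P : Params) : Module ℝ (TCSpace P) := inferInstanceAs (Module ℝ (Mech P × L2 P.ℓ))

/-- The linear map `(u, β^(-1/2) η)` that defines the norm of `H`. -/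
def GPSpace.energyMap (P : Params) : GPSpace P →ₗ[ℝ] WithLp 2 (Mech P × Memory P) where
  toFun z := WithLp.toLp 2 (z.1, √(1 / P.β) • z.2)
  map_add' z w := by
    have h1 : (z + w).1 = z.1 + w.1 := rfl
    have h2 : (z + w).2 = z.2 + w.2 := rfl
    rw [h1, h2, smul_add, ← WithLp.toLp_add, Prod.mk_add_mk]
  map_smul' c z := by
    have h1 : (c • z).1 = c • z.1 := rfl
    have h2 : (c • z).2 = c • z.2 := rfl
    rw [h1, h2, smul_comm, RingHom.id_apply, ← WithLp.toLp_smul, Prod.smul_mk]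

/-- The linear map `(u, √τ q)` that defines the norm of `Ĥ`. -/
def TCSpace.energyMap (P : Params) : TCSpace P →ₗ[ℝ] WithLp 2 (Mech P × L2 P.ℓ) where
  toFun z := WithLp.toLp 2 (z.1, √P.τ • z.2)
  map_add' z w := by
    have h1 : (z + w).1 = z.1 + w.1 := rfl
    have h2 : (z + w).2 = z.2 + w.2 := rfl
    rw [h1, h2, smul_add, ← WithLp.toLp_add, Prod.mk_add_mk]
  map_smul' c z := by
    have h1 : (c • z).1 = c • z.1 := rfl
    have h2 : (c • z).2 = c • z.2 := rfl
    rw [h1, h2, smul_comm, RingHom.id_apply, ← WithLp.toLp_smul, Prod.smul_mk]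

theorem GPSpace.energyMap_injective (P : Params) : Function.Injective (GPSpace.energyMap P) := by
  refine (injective_iff_map_eq_zero _).mpr fun z hz => ?_
  have k := (Real.sqrt_pos.mpr (one_div_pos.mpr P.β_pos)).ne'
  have e1 : z.1 = 0 := congrArg (fun w => w.fst) hz
  have e2 : √(1 / P.β) • z.2 = 0 := congrArg (fun w => w.snd) hz
  exact Prod.ext e1 ((smul_eq_zero.mp e2).resolve_left k)

theorem TCSpace.energyMap_injective (P : Params) : Function.Injective (TCSpace.energyMap P) := by
  refine (injective_iff_map_eq_zero _).mpr fun z hz => ?_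
  have k := (Real.sqrt_pos.mpr P.τ_pos).ne'
  have e1 : z.1 = 0 := congrArg (fun w => w.fst) hz
  have e2 : √P.τ • z.2 = 0 := congrArg (fun w => w.snd) hz
  exact Prod.ext e1 ((smul_eq_zero.mp e2).resolve_left k)

instance (P : Params) : NormedAddCommGroup (GPSpace P) :=
  NormedAddCommGroup.induced (GPSpace P) (WithLp 2 (Mech P × Memory P)) (GPSpace.energyMap P)
    (GPSpace.energyMap_injective P)
instance (P : Params) : NormedSpace ℝ (GPSpace P) where
  norm_smul_le c z := by
    change ‖GPSpace.energyMap P (c • z)‖ ≤ ‖c‖ * ‖GPSpace.energyMap P z‖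
    rw [map_smul]
    exact norm_smul_le c _
instance (P : Params) : NormedAddCommGroup (TCSpace P) :=
  NormedAddCommGroup.induced (TCSpace P) (WithLp 2 (Mech P × L2 P.ℓ)) (TCSpace.energyMap P)
    (TCSpace.energyMap_injective P)
instance (P : Params) : NormedSpace ℝ (TCSpace P) where
  norm_smul_le c z := by
    change ‖TCSpace.energyMap P (c • z)‖ ≤ ‖c‖ * ‖TCSpace.energyMap P z‖
    rw [map_smul]
    exact norm_smul_le c _

theorem GPSpace.norm_sq {P : Params} (z : GPSpace P) :
    ‖z‖ ^ 2 = ‖z.1‖ ^ 2 + 1 / P.β * ‖z.2‖ ^ 2 := by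
  have h : ‖z‖ = ‖GPSpace.energyMap P z‖ := rfl
  rw [h]
  rw [WithLp.prod_norm_sq_eq_of_L2]
  change ‖z.1‖ ^ 2 + ‖√(1 / P.β) • z.2‖ ^ 2 = _
  rw [norm_smul, mul_pow, Real.norm_eq_abs, sq_abs, Real.sq_sqrt (one_div_pos.mpr P.β_pos).le]

theorem TCSpace.norm_sq {P : Params} (z : TCSpace P) :
    ‖z‖ ^ 2 = ‖z.1‖ ^ 2 + P.τ * ‖z.2‖ ^ 2 := by
  have h : ‖z‖ = ‖TCSpace.energyMap P z‖ := rfl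
  rw [h]
  rw [WithLp.prod_norm_sq_eq_of_L2]
  change ‖z.1‖ ^ 2 + ‖√P.τ • z.2‖ ^ 2 = _
  rw [norm_smul, mul_pow, Real.norm_eq_abs, sq_abs, Real.sq_sqrt P.τ_pos.le]

/-! ### The operators generating the two semigroups -/

/-- The part of the two evolution operators that they have in common: `u = (φ, φ̃, ψ, ψ̃, θ)`
satisfies `φ ∈ H²`, `φ̃ ∈ H₀¹`, `ψ_x ∈ H₀¹`, `ψ̃ ∈ H¹_*`, `θ ∈ H₀¹` (the element `ϑ` of `H₀¹` is
`θ`), and the first four components of the image of `u` are those of `v`, that is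
`φ̃`, `(κ/ρ₁) (φ_x + ψ)_x`, `ψ̃` and `(b/ρ₂) ψ_xx - (κ/ρ₂) (φ_x + ψ) - (δ/ρ₂) θ_x`. -/
def MechRows {P : Params} (u v : Mech P) (ϑ : H10 P.ℓ) : Prop :=
  ∃ (φxx : L2 P.ℓ) (ψx : H10 P.ℓ),
    HasWeakDeriv u.φ.grad φxx ∧
    ψx.val = u.ψ.grad ∧
    ϑ.val = u.θ ∧
    v.φ.val = u.φt ∧
    v.φt = (P.κ / P.ρ₁) • (φxx + u.ψ.grad) ∧
    v.ψ.val = (u.ψt : L2 P.ℓ) ∧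
    (v.ψt : L2 P.ℓ) = (P.b / P.ρ₂) • ψx.grad - (P.κ / P.ρ₂) • (u.φ.grad + u.ψ.val)
      - (P.δ / P.ρ₂) • ϑ.grad

/-- The graph of the operator of the Timoshenko-Gurtin-Pipkin system: `z` belongs to its domain
and is mapped to `w`. Beyond the common part, `η` is in the domain of `T`, the function
`∫ μ(s) η(s) ds` is in `H²` with second derivative `Yxx`, the fifth component of the image is
`(1/(β ρ₃)) Yxx - (δ/ρ₃) ψ̃_x`, and the sixth one is `T η + θ`; note `ψ̃_x = (w.1.ψ)_x`. -/
def GPGenerator {P : Params} (z w : GPSpace P) : Prop :=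
  ∃ (ϑ : H10 P.ℓ) (Tη : Memory P) (Yxx : L2 P.ℓ),
    MechRows z.1 w.1 ϑ ∧
    MemoryGenerator z.2 Tη ∧
    HasWeakDeriv (H10.grad (∫ s, z.2 s ∂P.μds)) Yxx ∧
    w.1.θ = (1 / (P.β * P.ρ₃)) • Yxx - (P.δ / P.ρ₃) • w.1.ψ.grad ∧
    w.2 =ᵐ[P.μds] fun s => Tη s + ϑ

/-- The graph of the operator of the Timoshenko-Cattaneo system: `z` belongs to its domain
and is mapped to `w`. Beyond the common part, `q ∈ H¹`, the fifth component of the image is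
`-(1/ρ₃) q_x - (δ/ρ₃) ψ̃_x`, and the sixth one is `-(β/τ) q - (1/τ) θ_x`. -/
def TCGenerator {P : Params} (z w : TCSpace P) : Prop :=
  ∃ (ϑ : H10 P.ℓ) (qx : L2 P.ℓ),
    MechRows z.1 w.1 ϑ ∧
    HasWeakDeriv z.2 qx ∧
    w.1.θ = -(1 / P.ρ₃) • qx - (P.δ / P.ρ₃) • w.1.ψ.grad ∧
    w.2 = -(P.β / P.τ) • z.2 - (1 / P.τ) • ϑ.grad

/-! ### Semigroups -/

section Semigroup

variable {E : Type*} [NormedAddCommGroup E] [NormedSpace ℝ E]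

/-- `S` is a strongly continuous semigroup of bounded linear operators on `E`. -/
structure IsC0Semigroup (S : ℝ≥0 → E →L[ℝ] E) : Prop where
  zero : S 0 = ContinuousLinearMap.id ℝ E
  add : ∀ s t, S (s + t) = (S s).comp (S t)
  tendsto_zero : ∀ z, Tendsto (fun t => S t z) (𝓝 0) (𝓝 z)

/-- `S` is the strongly continuous semigroup generated by the operator with graph `A`: the
infinitesimal generator of `S` (including its domain) is exactly this operator. -/
structure IsSemigroupGeneratedBy (S : ℝ≥0 → E →L[ℝ] E) (A : E → E → Prop) : Prop where
  semigroup : IsC0Semigroup S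
  generator : ∀ z w, A z w ↔
    Tendsto (fun t : ℝ≥0 => (t : ℝ)⁻¹ • (S t z - z)) (𝓝[>] 0) (𝓝 w)

/-- Exponential stability of a semigroup. -/
def IsExpStable (S : ℝ≥0 → E →L[ℝ] E) : Prop :=
  ∃ r > (0 : ℝ), ∃ C ≥ (1 : ℝ), ∀ (t : ℝ≥0) (z : E), ‖S t z‖ ≤ C * Real.exp (-r * t) * ‖z‖

end Semigroup

end Timoshenko

end

namespace Timoshenko

/-! ### Strongly continuous semigroups -/

namespace IsC0Semigroup

variable {E F : Type*} [NormedAddCommGroup E] [NormedSpace ℝ E]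
  [NormedAddCommGroup F] [NormedSpace ℝ F] {S : ℝ≥0 → E →L[ℝ] E}

/-! The kernel is an exponential, so the memory enters the heat equation only through one moment,
and that moment obeys the Cattaneo law. Let `toCattaneo` be the bounded map L(u, η) = (u, q) with q
= -(1/β) ∫ μ(s) η_x(s) ds. Since μ' = -(β/τ) μ, integrating Tη against μ by parts gives -(β/τ) ∫ μ
η; there is no boundary term because η vanishes at s = 0 (`MemoryGenerator.integral_eq`). The term θ
in the memory equation, constant in s, contributes (β/τ) θ because μ has mass β/τ. Hence q is sent
to -(β/τ) q - (1/τ) θ_x, and L carries the Gurtin–Pipkin generator into the Cattaneo generator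
(`GPGenerator.toCattaneo`).

By `IsC0Semigroup.intertwine`, L then intertwines the semigroups themselves, so decay passes to
every state in the range of L. A flux in this range has zero mean, being the derivative of an `H10`
function. Conversely every zero-mean flux is reached, by a memory constant in s and without increase
of norm (`exists_toCattaneo_eq`).

What is left is the line of constant fluxes. There q_x = 0 and all other components vanish, so such
a state is an eigenvector with eigenvalue -β/τ and decays explicitly (`TCGenerator.const`,
`IsC0Semigroup.apply_eigenvector`). Splitting the flux into its mean and the rest gives the decay
rate min(r, β/τ). Completeness of the two phase spaces is needed because the semigroup lemmas rest
on Banach–Steinhaus and on Bochner integrals. -/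

theorem add_apply (hS : IsC0Semigroup S) (s t : ℝ≥0) (z : E) : S (s + t) z = S s (S t z) := by
  rw [hS.add]; rfl

/-- A strongly continuous semigroup is bounded near the origin. -/
theorem exists_bound_near_zero [CompleteSpace E] (hS : IsC0Semigroup S) :
    ∃ δ > (0 : ℝ≥0), ∃ M : ℝ, ∀ t ≤ δ, ‖S t‖ ≤ M := by
  by_contra! hcon
  have hpos : ∀ n : ℕ, (0 : ℝ≥0) < 1 / (n + 1) := fun n => by positivity
  -- If boundedness fails, there are times tending to 0 with operator norms exceeding every n.
  -- Strong continuity at 0 bounds each orbit along these times, against the uniform boundedness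
  -- principle.
  choose u hu hu' using fun n : ℕ => hcon (1 / (n + 1)) (hpos n) n
  have hlim : Tendsto u atTop (𝓝 0) :=
    tendsto_of_tendsto_of_tendsto_of_le_of_le tendsto_const_nhds
      (tendsto_one_div_add_atTop_nhds_zero_nat (𝕜 := ℝ≥0)) (fun _ => zero_le) hu
  obtain ⟨C, hC⟩ := banach_steinhaus (g := fun n => S (u n)) fun z => by
    obtain ⟨C, hC⟩ := ((hS.tendsto_zero z).comp hlim).norm.bddAbove_range
    exact ⟨C, fun n => hC (mem_range_self n)⟩
  obtain ⟨n, hn⟩ := exists_nat_gt C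
  exact (hn.trans (hu' n)).not_ge (hC n)

/-- A strongly continuous semigroup is bounded on bounded time intervals. -/
theorem exists_bound [CompleteSpace E] (hS : IsC0Semigroup S) (T : ℝ≥0) :
    ∃ M : ℝ, ∀ t ≤ T, ‖S t‖ ≤ M := by
  obtain ⟨δ, hδ, M, hM⟩ := hS.exists_bound_near_zero
  have key : ∀ n : ℕ, ∃ K : ℝ, ∀ t ≤ n * δ, ‖S t‖ ≤ K := by
    intro n
    induction n with
    | zero =>
      refine ⟨M, fun t ht => hM t (ht.trans ?_)⟩
      simp
    | succ n ih =>
      obtain ⟨K, hK⟩ := ih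
      refine ⟨max M (‖S δ‖ * K), fun t ht => ?_⟩
      rcases le_total t δ with h | h
      · exact (hM t h).trans (le_max_left _ _)
      · obtain ⟨r, rfl⟩ := exists_add_of_le h
        refine le_max_of_le_right ?_
        rw [hS.add]
        refine ((S δ).opNorm_comp_le (S r)).trans ?_
        gcongr
        apply hK
        push_cast at ht
        rw [add_mul, one_mul, add_comm] at ht
        exact le_of_add_le_add_right ht
  obtain ⟨n, hn⟩ := exists_nat_ge (T / δ)
  obtain ⟨K, hK⟩ := key n
  exact ⟨K, fun t ht => hK t (ht.trans ((div_le_iff₀ hδ).mp hn))⟩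

/-- A strongly continuous semigroup is jointly continuous in time and state. -/
theorem continuous_uncurry [CompleteSpace E] (hS : IsC0Semigroup S) :
    Continuous fun p : ℝ≥0 × E => S p.1 p.2 := by
  rw [continuous_iff_continuousAt]
  rintro ⟨t, z⟩
  obtain ⟨M, hM⟩ := hS.exists_bound (t + 1)
  have hM0 : 0 ≤ M := (norm_nonneg _).trans (hM 0 zero_le)
  -- Subtraction in `ℝ≥0` is truncated, so `(s - t) + (t - s)` is the distance |s - t|. Factoring
  -- out the semigroup at the smaller time reduces continuity at t, from both sides, to continuity
  -- at 0.
  have hdiff : ∀ s ≤ t + 1, ‖S s z - S t z‖ ≤ M * ‖S ((s - t) + (t - s)) z - z‖ := by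
    intro s hs
    rcases le_total t s with h | h
    · obtain ⟨r, rfl⟩ := exists_add_of_le h
      rw [hS.add_apply, ← map_sub, add_tsub_cancel_left, tsub_eq_zero_of_le h, add_zero]
      exact (S t).le_of_opNorm_le (hM t le_self_add) _
    · obtain ⟨r, rfl⟩ := exists_add_of_le h
      rw [hS.add_apply, ← map_sub, add_tsub_cancel_left, tsub_eq_zero_of_le h, zero_add,
        norm_sub_rev (S r z)]
      exact (S s).le_of_opNorm_le (hM s hs) _
  rw [ContinuousAt, tendsto_iff_norm_sub_tendsto_zero]
  have hfst : Tendsto (fun p : ℝ≥0 × E => (p.1 - t) + (t - p.1)) (𝓝 (t, z)) (𝓝 0) := by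
    have : Continuous fun p : ℝ≥0 × E => (p.1 - t) + (t - p.1) := by fun_prop
    simpa using this.tendsto (t, z)
  have hlim : Tendsto (fun p : ℝ≥0 × E => M * ‖p.2 - z‖
      + M * ‖S ((p.1 - t) + (t - p.1)) z - z‖) (𝓝 (t, z)) (𝓝 0) := by
    have h1 : Tendsto (fun p : ℝ≥0 × E => ‖p.2 - z‖) (𝓝 (t, z)) (𝓝 0) := by
      have : Continuous fun p : ℝ≥0 × E => ‖p.2 - z‖ := by fun_prop
      simpa using this.tendsto (t, z)
    have h2 := tendsto_iff_norm_sub_tendsto_zero.mp ((hS.tendsto_zero z).comp hfst)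
    simpa using (h1.const_mul M).add (h2.const_mul M)
  refine squeeze_zero' (Eventually.of_forall fun _ => norm_nonneg _) ?_ hlim
  have hnear : ∀ᶠ p : ℝ≥0 × E in 𝓝 (t, z), p.1 < t + 1 :=
    continuous_fst.tendsto (t, z) (Iio_mem_nhds (lt_add_of_pos_right t one_pos))
  filter_upwards [hnear] with p hp
  have : S p.1 p.2 - S t z = S p.1 (p.2 - z) + (S p.1 z - S t z) := by
    rw [map_sub]; abel
  rw [this]
  exact (norm_add_le _ _).trans (add_le_add ((S p.1).le_of_opNorm_le (hM _ hp.le) _)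
    (hdiff _ hp.le))

theorem continuous_orbit [CompleteSpace E] (hS : IsC0Semigroup S) (z : E) :
    Continuous fun t => S t z :=
  hS.continuous_uncurry.comp (Continuous.prodMk_left z)

/-- The domain of the generator is invariant under the semigroup. -/
theorem tendsto_quotient_apply (hS : IsC0Semigroup S) {z w : E}
    (h : Tendsto (fun t : ℝ≥0 => (t : ℝ)⁻¹ • (S t z - z)) (𝓝[>] 0) (𝓝 w)) (s : ℝ≥0) :
    Tendsto (fun t : ℝ≥0 => (t : ℝ)⁻¹ • (S t (S s z) - S s z)) (𝓝[>] 0) (𝓝 (S s w)) := by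
  refine (((S s).continuous.tendsto w).comp h).congr fun t => ?_
  simp only [Function.comp_apply]
  rw [map_smul, map_sub, ← hS.add_apply, ← hS.add_apply, add_comm]

/-- The generator of a strongly continuous semigroup on a Banach space is densely defined. -/
theorem dense_domain [CompleteSpace E] (hS : IsC0Semigroup S) :
    Dense {z : E | ∃ w, Tendsto (fun t : ℝ≥0 => (t : ℝ)⁻¹ • (S t z - z)) (𝓝[>] 0) (𝓝 w)} := by
  intro z
  set f : ℝ → E := fun s => S s.toNNReal z with hf
  have hfc : Continuous f := (hS.continuous_orbit z).comp continuous_real_toNNReal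
  have hder : ∀ x, HasDerivAt (fun y => ∫ s in (0 : ℝ)..y, f s) (f x) x := fun x =>
    (hfc.integral_hasStrictDerivAt 0 x).hasDerivAt
  have hcoe : Tendsto (fun t : ℝ≥0 => (t : ℝ)) (𝓝[>] 0) (𝓝[≠] 0) := by
    refine tendsto_nhdsWithin_iff.mpr ⟨?_, ?_⟩
    · exact (NNReal.continuous_coe.tendsto 0).mono_left nhdsWithin_le_nhds
    · filter_upwards [self_mem_nhdsWithin] with t ht
      exact (NNReal.coe_pos.mpr ht).ne'
  have hq : ∀ x, Tendsto (fun t : ℝ≥0 => (t : ℝ)⁻¹ • ((∫ s in (0 : ℝ)..(x + t), f s)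
      - ∫ s in (0 : ℝ)..x, f s)) (𝓝[>] 0) (𝓝 (f x)) := fun x =>
    (hasDerivAt_iff_tendsto_slope_zero.mp (hder x)).comp hcoe
  have hf0 : f 0 = z := by simp [hf, hS.zero]
  have hlim : Tendsto (fun h : ℝ≥0 => (h : ℝ)⁻¹ • ∫ s in (0 : ℝ)..h, f s) (𝓝[>] 0) (𝓝 z) := by
    have := hq 0
    simpa [hf0] using this
  refine mem_closure_of_tendsto hlim (Eventually.of_forall fun h => ?_)
  -- The averages of an orbit over [0, h] lie in the domain: applying S(t) shifts the interval to
  -- [t, h + t], and the difference of the two integrals reduces to short integrals at the two ends.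
  have hmain : Tendsto (fun t : ℝ≥0 => (t : ℝ)⁻¹ • (S t (∫ s in (0 : ℝ)..h, f s)
      - ∫ s in (0 : ℝ)..h, f s)) (𝓝[>] 0) (𝓝 (f h - f 0)) := by
    refine ((hq h).sub (hq 0)).congr fun t => ?_
    have e1 : S t (∫ s in (0 : ℝ)..h, f s) = ∫ s in (t : ℝ)..(h + t), f s := by
      rw [← (S t).intervalIntegral_comp_comm (hfc.intervalIntegrable _ _)]
      have e2 := intervalIntegral.integral_comp_add_right (a := 0) (b := (h : ℝ)) f t
      rw [zero_add] at e2
      rw [← e2]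
      apply intervalIntegral.integral_congr
      intro s hs
      rw [uIcc_of_le h.coe_nonneg] at hs
      simp only [hf]
      rw [← hS.add_apply, Real.toNNReal_add hs.1 t.coe_nonneg, Real.toNNReal_coe, add_comm]
    have e3 := intervalIntegral.integral_interval_sub_left
      (hfc.intervalIntegrable (μ := volume) 0 (h + t)) (hfc.intervalIntegrable 0 t)
    rw [e1, ← e3, zero_add, intervalIntegral.integral_same, ← smul_sub]
    congr 1
    abel
  refine ⟨(h : ℝ)⁻¹ • (f h - f 0), (hmain.const_smul _).congr fun t => ?_⟩
  rw [map_smul, ← smul_sub, smul_comm]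

/-- A bounded operator that intertwines the generators of two strongly continuous semigroups
intertwines the semigroups. -/
theorem intertwine [CompleteSpace E] [CompleteSpace F] (hS : IsC0Semigroup S)
    {R : ℝ≥0 → F →L[ℝ] F} (hR : IsC0Semigroup R) (L : E →L[ℝ] F)
    (hL : ∀ z w, Tendsto (fun t : ℝ≥0 => (t : ℝ)⁻¹ • (S t z - z)) (𝓝[>] 0) (𝓝 w) →
      Tendsto (fun t : ℝ≥0 => (t : ℝ)⁻¹ • (R t (L z) - L z)) (𝓝[>] 0) (𝓝 (L w)))
    (t : ℝ≥0) (z : E) : L (S t z) = R t (L z) := by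
  have hclosed : IsClosed {z : E | L (S t z) = R t (L z)} :=
    isClosed_eq (by fun_prop) (by fun_prop)
  refine hclosed.closure_subset_iff.mpr ?_ (hS.dense_domain z)
  rintro z ⟨w, hw⟩
  -- The path s ↦ R(t - s) L S(s) z joins R(t) L z to L S(t) z. For z in the domain its right
  -- derivative is zero, so the two ends agree.
  set v : ℝ → F := fun s => R ((t : ℝ) - s).toNNReal (L (S s.toNNReal z)) with hv
  have hvc : Continuous v := by
    have h1 := (hS.continuous_orbit z).comp continuous_real_toNNReal
    have h2 : Continuous fun s : ℝ => ((t : ℝ) - s).toNNReal :=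
      continuous_real_toNNReal.comp (by fun_prop)
    exact hR.continuous_uncurry.comp (h2.prodMk (L.continuous.comp h1))
  obtain ⟨M, hM⟩ := hR.exists_bound t
  have hder : ∀ s ∈ Ico (0 : ℝ) t, HasDerivWithinAt v 0 (Ici s) s := by
    intro s hs
    rw [hasDerivWithinAt_iff_tendsto_slope, Ici_sdiff_left]
    have h1 := hS.tendsto_quotient_apply hw s.toNNReal
    have h2 := hL _ _ h1
    have h3 := ((L.continuous.tendsto _).comp h1).sub h2
    rw [sub_self] at h3
    have h4 : Tendsto (fun r : ℝ => (r - s).toNNReal) (𝓝[>] s) (𝓝[>] 0) := by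
      refine tendsto_nhdsWithin_iff.mpr ⟨?_, ?_⟩
      · have : Continuous fun r : ℝ => (r - s).toNNReal :=
          continuous_real_toNNReal.comp (by fun_prop)
        have h5 := this.tendsto s
        rw [sub_self, Real.toNNReal_zero] at h5
        exact h5.mono_left nhdsWithin_le_nhds
      · filter_upwards [self_mem_nhdsWithin] with r hr
        exact Real.toNNReal_pos.mpr (sub_pos.mpr hr)
    have h5 := ((h3.comp h4).norm).const_mul M
    rw [norm_zero, mul_zero] at h5
    refine squeeze_zero_norm' ?_ h5
    filter_upwards [Ioo_mem_nhdsGT hs.2] with r hr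
    set k : ℝ≥0 := (r - s).toNNReal with hk
    have hks : (k : ℝ) = r - s := Real.coe_toNNReal _ (sub_nonneg.mpr hr.1.le)
    have er : r.toNNReal = k + s.toNNReal := by
      rw [hk, ← Real.toNNReal_add (sub_nonneg.mpr hr.1.le) hs.1, sub_add_cancel]
    have et : ((t : ℝ) - s).toNNReal = ((t : ℝ) - r).toNNReal + k := by
      rw [hk, ← Real.toNNReal_add (sub_nonneg.mpr hr.2.le) (sub_nonneg.mpr hr.1.le),
        sub_add_sub_cancel]
    -- The slope is R(t - r) applied to a difference of two quotients, both of which tend to L S(s)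
    -- w. The bound M on R over [0, t] absorbs the dependence of R(t - r) on r.
    have e : slope v s r = R ((t : ℝ) - r).toNNReal
        (L ((k : ℝ)⁻¹ • (S k (S s.toNNReal z) - S s.toNNReal z))
          - (k : ℝ)⁻¹ • (R k (L (S s.toNNReal z)) - L (S s.toNNReal z))) := by
      rw [slope_def_module, ← hks, hv]
      simp only
      rw [er, et, hS.add_apply, hR.add_apply, ← map_sub, ← map_smul, map_smul L, ← smul_sub,
        map_sub L]
      congr 2
      abel
    rw [e]
    refine (R _).le_of_opNorm_le (hM _ ?_) _
    rw [Real.toNNReal_le_iff_le_coe]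
    linarith [hs.1, hr.1]
  have hconst := constant_of_has_deriv_right_zero hvc.continuousOn hder t ⟨t.2, le_rfl⟩
  simpa [hv, hS.zero, hR.zero] using hconst

end IsC0Semigroup

/-- The orbit of an eigenvector of the generator. -/
theorem IsC0Semigroup.apply_eigenvector {E : Type*} [NormedAddCommGroup E] [NormedSpace ℝ E]
    [CompleteSpace E] {S : ℝ≥0 → E →L[ℝ] E} (hS : IsC0Semigroup S) {z : E} {a : ℝ}
    (h : Tendsto (fun t : ℝ≥0 => (t : ℝ)⁻¹ • (S t z - z)) (𝓝[>] 0) (𝓝 (a • z))) (t : ℝ≥0) :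
    S t z = Real.exp (a * t) • z := by
  let R : ℝ≥0 → ℝ →L[ℝ] ℝ := fun t => Real.exp (a * t) • ContinuousLinearMap.id ℝ ℝ
  have hR : IsC0Semigroup R := by
    refine ⟨by simp [R], fun s t => ?_, fun x => ?_⟩
    · ext
      simp [R, mul_add, Real.exp_add, mul_comm]
    · have : Continuous fun t : ℝ≥0 => R t x := by
        simp only [R, _root_.smul_apply]
        fun_prop
      simpa [R] using this.tendsto 0
  have hder : Tendsto (fun t : ℝ≥0 => (t : ℝ)⁻¹ * (Real.exp (a * t) - 1)) (𝓝[>] 0) (𝓝 a) := by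
    have h1 : HasDerivAt (fun x : ℝ => Real.exp (a * x)) a 0 := by
      simpa using ((hasDerivAt_id (0 : ℝ)).const_mul a).exp
    have hcoe : Tendsto (fun t : ℝ≥0 => (t : ℝ)) (𝓝[>] 0) (𝓝[≠] 0) := by
      refine tendsto_nhdsWithin_iff.mpr ⟨?_, ?_⟩
      · exact (NNReal.continuous_coe.tendsto 0).mono_left nhdsWithin_le_nhds
      · filter_upwards [self_mem_nhdsWithin] with t ht
        exact (NNReal.coe_pos.mpr ht).ne'
    simpa [Function.comp_def] using (hasDerivAt_iff_tendsto_slope_zero.mp h1).comp hcoe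
  -- The scalar semigroup e^{at} on ℝ is carried into S by x ↦ x • z, which intertwines the
  -- generators exactly because z is an eigenvector. The claim is the value at x = 1.
  have key := hR.intertwine hS (ContinuousLinearMap.toSpanSingleton ℝ z) (fun x w hw => by
    have hw' : Tendsto (fun t : ℝ≥0 => (t : ℝ)⁻¹ • (R t x - x)) (𝓝[>] 0) (𝓝 (a * x)) := by
      refine (hder.mul_const x).congr fun t => ?_
      simp only [R, _root_.smul_apply, ContinuousLinearMap.id_apply, smul_eq_mul]
      ring
    rw [tendsto_nhds_unique hw hw']
    have := h.const_smul x
    simp only [ContinuousLinearMap.toSpanSingleton_apply, map_smul, ← smul_sub]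
    rw [mul_smul, smul_comm a]
    exact this.congr fun t => smul_comm _ _ _) t 1
  simpa [R] using key.symm

/-! ### Completeness of the phase spaces -/

variable {ℓ : ℝ}

/-- The constant function `1`. -/
noncomputable def L2.one (ℓ : ℝ) : L2 ℓ := Lp.const 2 (volume.restrict (Icc (0 : ℝ) ℓ)) 1

theorem L2.inner_one (f : L2 ℓ) : inner ℝ (L2.one ℓ) f = ∫ x in Icc 0 ℓ, f x := by
  rw [L2.inner_def]
  apply integral_congr_ae
  filter_upwards [Lp.coeFn_const 2 (volume.restrict (Icc (0 : ℝ) ℓ)) (1 : ℝ)] with x hx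
  change f x * L2.one ℓ x = f x
  rw [L2.one, hx, Function.const_apply, mul_one]

theorem zeroMean_iff_inner_one {f : L2 ℓ} : ZeroMean f ↔ inner ℝ (L2.one ℓ) f = 0 := by
  rw [L2.inner_one, ZeroMean]

theorem isClosed_zeroMean : IsClosed {f : L2 ℓ | ZeroMean f} := by
  simp only [zeroMean_iff_inner_one]
  exact isClosed_eq (by fun_prop) continuous_const

/-- The integral of ζ' is a difference of end values, and test functions vanish at both ends. This
lets constants be subtracted without changing a derivative, and puts constant fluxes in the Cattaneo
domain. -/
theorem HasWeakDeriv.one : HasWeakDeriv (L2.one ℓ) 0 := by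
  rcases le_or_gt ℓ 0 with hl | hl
  · rw [L2.subsingleton hl (L2.one ℓ) 0]
    exact HasWeakDeriv.zero
  intro ζ h1 h2 h3
  have e1 : ∫ x in Icc 0 ℓ, L2.one ℓ x * deriv ζ x = ∫ x in (0 : ℝ)..ℓ, deriv ζ x := by
    rw [intervalIntegral.integral_of_le hl.le, ← integral_Icc_eq_integral_Ioc]
    apply integral_congr_ae
    filter_upwards [Lp.coeFn_const 2 (volume.restrict (Icc (0 : ℝ) ℓ)) (1 : ℝ)] with x hx
    rw [L2.one, hx, Function.const_apply, one_mul]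
  have e2 : ∫ x in Icc 0 ℓ, (0 : L2 ℓ) x * ζ x = 0 := by
    rw [integral_eq_zero_of_ae]
    filter_upwards [Lp.coeFn_zero ℝ 2 (volume.restrict (Icc (0 : ℝ) ℓ))] with x hx
    rw [hx, Pi.zero_apply, zero_mul]
  have hz : ∀ x, x ∉ Ioo 0 ℓ → ζ x = 0 := fun x hx => by
    by_contra hne
    exact hx (h3 (subset_tsupport ζ hne))
  rw [e1, e2, intervalIntegral.integral_deriv_eq_sub'
    ζ rfl (fun x _ => (h1.differentiable (by simp)).differentiableAt)
    (h1.continuous_deriv (by simp)).continuousOn, hz ℓ (by simp), hz 0 (by simp)]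
  simp

/-- Every zero-mean function is the derivative of an element of `H₀¹`. -/
theorem H10.exists_grad_eq (hl : 0 ≤ ℓ) {g : L2 ℓ} (hg : ZeroMean g) :
    ∃ f : H10 ℓ, f.grad = g := by
  obtain ⟨p, hp, hpe, hpc⟩ := exists_primitive hl g
  have hend : ∫ t in (0 : ℝ)..ℓ, g t = 0 := by
    rw [intervalIntegral.integral_of_le hl, ← integral_Icc_eq_integral_Ioc]
    exact hg
  exact ⟨⟨(p, g), hp, _, hpc, hpe, by simp, hend⟩, rfl⟩

/-- The end values vanish, so the derivative integrates to zero. This is why `toCattaneo` misses the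
constant fluxes. -/
theorem H10.zeroMean_grad (hl : 0 < ℓ) (f : H10 ℓ) : ZeroMean f.grad :=
  (f.hasWeakDeriv.eq_primitive hl f.vanishesAtEnds).2

/-- The mean-value decomposition of `L²`. -/
theorem L2.exists_mean (f : L2 ℓ) : ∃ c : ℝ, ZeroMean (f - c • L2.one ℓ) ∧
    ‖c • L2.one ℓ‖ ≤ ‖f‖ := by
  -- The mean is the orthogonal projection onto the constants, so the norm bound comes for free.
  set K : Submodule ℝ (L2 ℓ) := Submodule.span ℝ {L2.one ℓ}
  obtain ⟨c, hc⟩ := Submodule.mem_span_singleton.mp (K.starProjection_apply_mem f)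
  refine ⟨c, ?_, ?_⟩
  · rw [hc, zeroMean_iff_inner_one]
    rw [real_inner_comm]
    exact K.starProjection_inner_eq_zero f _ (Submodule.mem_span_singleton_self _)
  · rw [hc]
    exact K.norm_starProjection_apply_le f

/-- Every square summable function is the derivative of an element of `H¹_*`. -/
theorem H1s.exists_grad_eq (hl : 0 ≤ ℓ) (g : L2 ℓ) : ∃ f : H1s ℓ, f.grad = g := by
  obtain ⟨p, hp, -, -⟩ := exists_primitive hl g
  obtain ⟨c, hc, -⟩ := L2.exists_mean p
  have h : HasWeakDeriv (p - c • L2.one ℓ) g := by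
    have := hp.add (HasWeakDeriv.one.smul (-c))
    rwa [smul_zero, add_zero, neg_smul, ← sub_eq_add_neg] at this
  exact ⟨⟨(p - c • L2.one ℓ, g), h, hc⟩, rfl⟩

/-- The energy coordinates determine ψ from ψ_x and then φ_x as the first coordinate minus ψ; the
latter is solvable in `H10` exactly for zero mean. The range is thus cut out by closed conditions,
which yields completeness of `Mech`. -/
theorem Mech.mem_range_energyMap (P : Params)
    (x : WithLp 2 (L2 P.ℓ × WithLp 2 (L2 P.ℓ × WithLp 2 (L2 P.ℓ × WithLp 2 (L2 P.ℓ × L2 P.ℓ))))) :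
    x ∈ range (Mech.energyMap P) ↔ ZeroMean x.fst ∧ ZeroMean x.snd.snd.snd.fst := by
  constructor
  · rintro ⟨u, rfl⟩
    exact ⟨((u.φ.zeroMean_grad P.ℓ_pos).add u.ψ.zeroMean).smul _,
      ZeroMean.smul _ u.ψt.2⟩
  · rintro ⟨h1, h2⟩
    obtain ⟨ψ, hψ⟩ := H1s.exists_grad_eq P.ℓ_pos.le ((√P.b)⁻¹ • x.snd.snd.fst)
    obtain ⟨φ, hφ⟩ := H10.exists_grad_eq P.ℓ_pos.le
      ((h1.smul (√P.κ)⁻¹).add (ψ.zeroMean.smul (-1)))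
    have k1 := (Real.sqrt_pos.mpr P.κ_pos).ne'
    have k2 := (Real.sqrt_pos.mpr P.ρ₁_pos).ne'
    have k3 := (Real.sqrt_pos.mpr P.b_pos).ne'
    have k4 := (Real.sqrt_pos.mpr P.ρ₂_pos).ne'
    have k5 := (Real.sqrt_pos.mpr P.ρ₃_pos).ne'
    let u : Mech P := (φ, (√P.ρ₁)⁻¹ • x.snd.fst, ψ,
      ⟨(√P.ρ₂)⁻¹ • x.snd.snd.snd.fst, h2.smul _⟩, (√P.ρ₃)⁻¹ • x.snd.snd.snd.snd)
    refine ⟨u, ?_⟩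
    have e1 : √P.κ • (φ.grad + ψ.val) = x.fst := by
      rw [hφ, neg_one_smul, neg_add_cancel_right, smul_inv_smul₀ k1]
    have e2 : √P.ρ₁ • (√P.ρ₁)⁻¹ • x.snd.fst = x.snd.fst := smul_inv_smul₀ k2 _
    have e3 : √P.b • ψ.grad = x.snd.snd.fst := by rw [hψ, smul_inv_smul₀ k3]
    have e4 : √P.ρ₂ • (√P.ρ₂)⁻¹ • x.snd.snd.snd.fst = x.snd.snd.snd.fst := smul_inv_smul₀ k4 _
    have e5 : √P.ρ₃ • (√P.ρ₃)⁻¹ • x.snd.snd.snd.snd = x.snd.snd.snd.snd := smul_inv_smul₀ k5 _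
    change WithLp.toLp 2 (√P.κ • (φ.grad + ψ.val), WithLp.toLp 2 (√P.ρ₁ • (√P.ρ₁)⁻¹ • x.snd.fst,
      WithLp.toLp 2 (√P.b • ψ.grad, WithLp.toLp 2 (√P.ρ₂ • (√P.ρ₂)⁻¹ • x.snd.snd.snd.fst,
        √P.ρ₃ • (√P.ρ₃)⁻¹ • x.snd.snd.snd.snd)))) = x
    rw [e1, e2, e3, e4, e5]
    rfl

instance (P : Params) : CompleteSpace (Mech P) := by
  have hiso : Isometry (Mech.energyMap P) := AddMonoidHomClass.isometry_of_norm _ fun _ => rfl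
  rw [completeSpace_iff_isComplete_range hiso.isUniformInducing]
  have h : range (Mech.energyMap P) = {x | ZeroMean x.fst ∧ ZeroMean x.snd.snd.snd.fst} :=
    Set.ext (Mech.mem_range_energyMap P)
  rw [h]
  refine (IsClosed.inter ?_ ?_).isComplete
  · exact isClosed_zeroMean.preimage (by fun_prop)
  · exact isClosed_zeroMean.preimage (by fun_prop)

instance (P : Params) : CompleteSpace (GPSpace P) := by
  have hiso : Isometry (GPSpace.energyMap P) := AddMonoidHomClass.isometry_of_norm _ fun _ => rfl
  have k := (Real.sqrt_pos.mpr (one_div_pos.mpr P.β_pos)).ne'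
  refine (hiso.isUniformInducing.completeSpace_congr fun x =>
    ⟨(x.fst, (√(1 / P.β))⁻¹ • x.snd), ?_⟩).mpr inferInstance
  change WithLp.toLp 2 (x.fst, √(1 / P.β) • (√(1 / P.β))⁻¹ • x.snd) = x
  rw [smul_inv_smul₀ k]
  rfl

instance (P : Params) : CompleteSpace (TCSpace P) := by
  have hiso : Isometry (TCSpace.energyMap P) := AddMonoidHomClass.isometry_of_norm _ fun _ => rfl
  have k := (Real.sqrt_pos.mpr P.τ_pos).ne'
  refine (hiso.isUniformInducing.completeSpace_congr fun x =>
    ⟨(x.fst, (√P.τ)⁻¹ • x.snd), ?_⟩).mpr inferInstance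
  change WithLp.toLp 2 (x.fst, √P.τ • (√P.τ)⁻¹ • x.snd) = x
  rw [smul_inv_smul₀ k]
  rfl

/-! ### The memory space -/

variable {P : Params}

theorem Params.μ_eq (P : Params) (s : ℝ) :
    P.μ s = P.β ^ 2 / P.τ ^ 2 * Real.exp (-(P.β / P.τ) * s) := by
  rw [Params.μ]
  congr 2
  ring

theorem Params.μ_nonneg (P : Params) (s : ℝ) : 0 ≤ P.μ s := by
  have := P.β_pos
  have := P.τ_pos
  rw [Params.μ]
  positivity

theorem Params.contDiff_μ (P : Params) {n : WithTop ℕ∞} : ContDiff ℝ n P.μ := by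
  have : P.μ = fun s => P.β ^ 2 / P.τ ^ 2 * Real.exp (-(P.β / P.τ) * s) := funext P.μ_eq
  rw [this]
  fun_prop

/-- This differential equation for the kernel is what closes the equation for the flux. -/
theorem Params.hasDerivAt_μ (P : Params) (s : ℝ) :
    HasDerivAt P.μ (-(P.β / P.τ) * P.μ s) s := by
  have h : HasDerivAt (fun s => P.β ^ 2 / P.τ ^ 2 * Real.exp (-(P.β / P.τ) * s))
      (P.β ^ 2 / P.τ ^ 2 * (Real.exp (-(P.β / P.τ) * s) * (-(P.β / P.τ) * 1))) s :=
    (((hasDerivAt_id s).const_mul _).exp).const_mul _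
  rw [funext P.μ_eq]
  convert h using 1
  ring

theorem Params.μ_le (P : Params) {s : ℝ} (hs : 0 ≤ s) : P.μ s ≤ P.μ 0 := by
  have := P.β_pos
  have := P.τ_pos
  rw [P.μ_eq, P.μ_eq]
  gcongr P.β ^ 2 / P.τ ^ 2 * Real.exp ?_
  rw [mul_zero, neg_mul]
  exact neg_nonpos.mpr (by positivity)

theorem Params.integrableOn_μ (P : Params) : IntegrableOn P.μ (Ioi 0) := by
  rw [funext P.μ_eq]
  exact (integrableOn_exp_mul_Ioi (neg_lt_zero.mpr (div_pos P.β_pos P.τ_pos)) 0).const_mul _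

theorem Params.integral_μ (P : Params) : ∫ s in Ioi 0, P.μ s = P.β / P.τ := by
  have h := div_pos P.β_pos P.τ_pos
  simp only [P.μ_eq]
  rw [integral_const_mul, integral_exp_mul_Ioi (neg_lt_zero.mpr h), ← div_pow]
  simp only [mul_zero, Real.exp_zero]
  field_simp

theorem Params.μds_univ (P : Params) : P.μds univ = ENNReal.ofReal (P.β / P.τ) := by
  rw [Params.μds, withDensity_apply _ MeasurableSet.univ, Measure.restrict_univ,
    ← ofReal_integral_eq_lintegral_ofReal P.integrableOn_μ
      (Eventually.of_forall fun s => P.μ_nonneg s), P.integral_μ]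

instance (P : Params) : IsFiniteMeasure P.μds := ⟨by rw [P.μds_univ]; exact ENNReal.ofReal_lt_top⟩

theorem Params.μds_real_univ (P : Params) : P.μds.real univ = P.β / P.τ := by
  rw [Measure.real, P.μds_univ, ENNReal.toReal_ofReal (div_pos P.β_pos P.τ_pos).le]

/-- Linear smallness near 0 compensates for the factor n in `cutoffRise n`, which lives on [0, 2/n].
-/
theorem Params.μds_real_Icc_le (P : Params) {a : ℝ} (ha : 0 ≤ a) :
    P.μds.real (Icc 0 a) ≤ P.μ 0 * a := by
  refine ENNReal.toReal_le_of_le_ofReal (mul_nonneg (P.μ_nonneg 0) ha) ?_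
  rw [Params.μds, withDensity_apply _ measurableSet_Icc,
    Measure.restrict_restrict measurableSet_Icc]
  calc ∫⁻ s in Icc 0 a ∩ Ioi 0, ENNReal.ofReal (P.μ s)
      ≤ ∫⁻ s in Icc 0 a, ENNReal.ofReal (P.μ s) := lintegral_mono_set inter_subset_left
    _ ≤ ∫⁻ _ in Icc 0 a, ENNReal.ofReal (P.μ 0) :=
        setLIntegral_mono measurable_const fun s hs => ENNReal.ofReal_le_ofReal (P.μ_le hs.1)
    _ = ENNReal.ofReal (P.μ 0 * a) := by
        rw [setLIntegral_const, Real.volume_Icc, sub_zero, ENNReal.ofReal_mul (P.μ_nonneg 0)]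

theorem Params.ae_μds_pos (P : Params) : ∀ᵐ s ∂P.μds, 0 < s :=
  (withDensity_absolutelyContinuous _ _).ae_le (ae_restrict_mem measurableSet_Ioi)

/-- The weak derivative in s is tested against Lebesgue measure; test functions carrying a factor μ
turn it into a statement about the memory measure. -/
theorem Params.setIntegral_μ_smul (P : Params) {E : Type*} [NormedAddCommGroup E]
    [NormedSpace ℝ E] (g : ℝ → ℝ) (f : ℝ → E) :
    ∫ s in Ioi 0, (P.μ s * g s) • f s = ∫ s, g s • f s ∂P.μds := by
  rw [Params.μds, integral_withDensity_eq_integral_toReal_smul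
    (P.contDiff_μ (n := 0)).continuous.measurable.ennreal_ofReal
    (Eventually.of_forall fun _ => ENNReal.ofReal_lt_top)]
  simp only [ENNReal.toReal_ofReal (P.μ_nonneg _), mul_smul]

theorem Memory.integrable (η : Memory P) : Integrable η P.μds :=
  (Lp.memLp η).integrable (by norm_num)

theorem Memory.integrable_smul (η : Memory P) {g : ℝ → ℝ} (hg : Continuous g) {C : ℝ}
    (hC : ∀ s, |g s| ≤ C) : Integrable (fun s => g s • η s) P.μds := by
  refine (η.integrable.norm.const_mul C).mono'
    (hg.aestronglyMeasurable.smul (Lp.aestronglyMeasurable η)) (Eventually.of_forall fun s => ?_)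
  rw [norm_smul]
  exact mul_le_mul_of_nonneg_right (hC s) (norm_nonneg _)

/-! ### Smooth cut-offs on the half-line -/

theorem smoothTransition_deriv_zero {x : ℝ} (hx : x < 0 ∨ 1 < x) :
    deriv Real.smoothTransition x = 0 := by
  rcases hx with hx | hx
  · have h : Real.smoothTransition =ᶠ[𝓝 x] fun _ => 0 := by
      filter_upwards [Iio_mem_nhds hx] with y hy
      exact Real.smoothTransition.zero_of_nonpos (le_of_lt hy)
    rw [h.deriv_eq, deriv_const]
  · have h : Real.smoothTransition =ᶠ[𝓝 x] fun _ => 1 := by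
      filter_upwards [Ioi_mem_nhds hx] with y hy
      exact Real.smoothTransition.one_of_one_le (le_of_lt hy)
    rw [h.deriv_eq, deriv_const]

theorem continuous_deriv_smoothTransition : Continuous (deriv Real.smoothTransition) :=
  (Real.smoothTransition.contDiff (n := 1)).continuous_deriv (by simp)

theorem exists_bound_deriv_smoothTransition :
    ∃ C : ℝ, ∀ x, |deriv Real.smoothTransition x| ≤ C := by
  obtain ⟨C, hC⟩ := isCompact_Icc.exists_bound_of_continuousOn (s := Icc (0 : ℝ) 1)
    continuous_deriv_smoothTransition.continuousOn
  refine ⟨C, fun x => ?_⟩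
  by_cases hx : x ∈ Icc (0 : ℝ) 1
  · exact hC x hx
  · rw [mem_Icc, not_and_or, not_le, not_le] at hx
    rw [smoothTransition_deriv_zero hx, abs_zero]
    exact (abs_nonneg _).trans (hC 0 (by simp))

/-- A smooth cut-off function, supported in `[1/n, n]` and equal to `1` on `[2/n, n-1]`. -/
noncomputable def cutoff (n : ℕ) (s : ℝ) : ℝ :=
  Real.smoothTransition (n * s - 1) * Real.smoothTransition (n - s)

/-- The derivative of the cut-off function near the origin. -/
noncomputable def cutoffRise (n : ℕ) (s : ℝ) : ℝ :=
  n * deriv Real.smoothTransition (n * s - 1) * Real.smoothTransition (n - s)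

/-- The derivative of the cut-off function near infinity, up to its sign. -/
noncomputable def cutoffFall (n : ℕ) (s : ℝ) : ℝ :=
  Real.smoothTransition (n * s - 1) * deriv Real.smoothTransition (n - s)

theorem contDiff_cutoff (n : ℕ) : ContDiff ℝ ∞ (cutoff n) :=
  (Real.smoothTransition.contDiff.comp (by fun_prop)).mul
    (Real.smoothTransition.contDiff.comp (by fun_prop))

theorem hasDerivAt_cutoff (n : ℕ) (s : ℝ) :
    HasDerivAt (cutoff n) (cutoffRise n s - cutoffFall n s) s := by
  have hd : ∀ x, HasDerivAt Real.smoothTransition (deriv Real.smoothTransition x) x := fun x =>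
    ((Real.smoothTransition.contDiff (n := 1)).differentiable (by simp) x).hasDerivAt
  have h1 : HasDerivAt (fun s : ℝ => n * s - 1) (n * 1) s :=
    ((hasDerivAt_id s).const_mul _).sub_const _
  have h2 : HasDerivAt (fun s : ℝ => n - s) (-1) s := (hasDerivAt_id s).const_sub _
  have h := ((hd (n * s - 1)).comp s h1).mul ((hd (n - s)).comp s h2)
  refine h.congr_deriv ?_
  simp only [cutoffRise, cutoffFall, Function.comp_apply]
  ring

theorem cutoff_eq_zero {n : ℕ} (hn : 0 < n) {s : ℝ} (hs : s ∉ Icc (1 / n : ℝ) n) :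
    cutoff n s = 0 := by
  have hn' : (0 : ℝ) < n := Nat.cast_pos.mpr hn
  rw [mem_Icc, not_and_or, not_le, not_le] at hs
  rcases hs with hs | hs
  · rw [cutoff, Real.smoothTransition.zero_of_nonpos, zero_mul]
    rw [lt_div_iff₀' hn'] at hs
    linarith
  · rw [cutoff, Real.smoothTransition.zero_of_nonpos (x := n - s), mul_zero]
    linarith

theorem abs_smoothTransition_le_one (x : ℝ) : |Real.smoothTransition x| ≤ 1 := by
  rw [abs_of_nonneg (Real.smoothTransition.nonneg x)]
  exact Real.smoothTransition.le_one x

theorem abs_cutoff_le_one (n : ℕ) (s : ℝ) : |cutoff n s| ≤ 1 := by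
  rw [cutoff, abs_mul]
  exact mul_le_one₀ (abs_smoothTransition_le_one _) (abs_nonneg _) (abs_smoothTransition_le_one _)

theorem eventually_cutoff_eq_one {s : ℝ} (hs : 0 < s) : ∀ᶠ n in atTop, cutoff n s = 1 := by
  filter_upwards [(tendsto_natCast_atTop_atTop (R := ℝ)).eventually_ge_atTop (2 / s),
    (tendsto_natCast_atTop_atTop (R := ℝ)).eventually_ge_atTop (s + 1)] with n h1 h2
  rw [div_le_iff₀ hs] at h1
  rw [cutoff, Real.smoothTransition.one_of_one_le (by linarith),
    Real.smoothTransition.one_of_one_le (by linarith), mul_one]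

theorem eventually_cutoffFall_eq_zero (s : ℝ) : ∀ᶠ n in atTop, cutoffFall n s = 0 := by
  filter_upwards [(tendsto_natCast_atTop_atTop (R := ℝ)).eventually_gt_atTop (s + 1)] with n h
  rw [cutoffFall, smoothTransition_deriv_zero (Or.inr (by linarith)), mul_zero]

theorem cutoffRise_eq_zero {n : ℕ} (hn : 0 < n) {s : ℝ} (hs : s ∉ Icc (0 : ℝ) (2 / n)) :
    cutoffRise n s = 0 := by
  have hn' : (0 : ℝ) < n := Nat.cast_pos.mpr hn
  rw [cutoffRise, smoothTransition_deriv_zero, mul_zero, zero_mul]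
  rw [mem_Icc, not_and_or, not_le, not_le] at hs
  rcases hs with hs | hs
  · left
    have := mul_neg_of_pos_of_neg hn' hs
    linarith
  · right
    rw [div_lt_iff₀' hn'] at hs
    linarith

theorem continuous_cutoffRise (n : ℕ) : Continuous (cutoffRise n) :=
  (continuous_const.mul (continuous_deriv_smoothTransition.comp (by fun_prop))).mul
    (Real.smoothTransition.continuous.comp (by fun_prop))

theorem continuous_cutoffFall (n : ℕ) : Continuous (cutoffFall n) :=
  (Real.smoothTransition.continuous.comp (by fun_prop)).mul
    (continuous_deriv_smoothTransition.comp (by fun_prop))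

theorem tendsto_integral_cutoff (η : Memory P) :
    Tendsto (fun n => ∫ s, cutoff n s • η s ∂P.μds) atTop (𝓝 (∫ s, η s ∂P.μds)) := by
  refine tendsto_integral_of_dominated_convergence (fun s => ‖η s‖) (fun n => ?_)
    η.integrable.norm (fun n => Eventually.of_forall fun s => ?_) ?_
  · exact (contDiff_cutoff n).continuous.aestronglyMeasurable.smul
      (Lp.aestronglyMeasurable η)
  · rw [norm_smul]
    exact mul_le_of_le_one_left (norm_nonneg _) (abs_cutoff_le_one n s)
  · filter_upwards [P.ae_μds_pos] with s hs
    refine tendsto_const_nhds.congr' ?_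
    filter_upwards [eventually_cutoff_eq_one hs] with n hn
    rw [hn, one_smul]

theorem integrable_cutoffFall (η : Memory P) (n : ℕ) :
    Integrable (fun s => cutoffFall n s • η s) P.μds := by
  obtain ⟨C, hC⟩ := exists_bound_deriv_smoothTransition
  refine η.integrable_smul (continuous_cutoffFall n) (C := C) fun s => ?_
  rw [cutoffFall, abs_mul]
  exact (mul_le_of_le_one_left (abs_nonneg _) (abs_smoothTransition_le_one _)).trans (hC _)

/-- The cut-off descends over an interval of length 1, so its slope is bounded uniformly in n and
dominated convergence applies. -/
theorem tendsto_integral_cutoffFall (η : Memory P) :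
    Tendsto (fun n => ∫ s, cutoffFall n s • η s ∂P.μds) atTop (𝓝 0) := by
  obtain ⟨C, hC⟩ := exists_bound_deriv_smoothTransition
  have h : Tendsto (fun n => ∫ s, cutoffFall n s • η s ∂P.μds) atTop
      (𝓝 (∫ _, (0 : H10 P.ℓ) ∂P.μds)) := by
    refine tendsto_integral_of_dominated_convergence (fun s => C * ‖η s‖)
      (fun n => (integrable_cutoffFall η n).aestronglyMeasurable)
      (η.integrable.norm.const_mul C) (fun n => Eventually.of_forall fun s => ?_)
      (Eventually.of_forall fun s => ?_)
    · rw [norm_smul, cutoffFall, norm_mul]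
      gcongr
      exact (mul_le_of_le_one_left (norm_nonneg _) (abs_smoothTransition_le_one _)).trans (hC _)
    · refine tendsto_const_nhds.congr' ?_
      filter_upwards [eventually_cutoffFall_eq_zero s] with n hn
      rw [hn, zero_smul]
  rwa [integral_zero] at h

theorem integrable_cutoffRise (η : Memory P) (n : ℕ) :
    Integrable (fun s => cutoffRise n s • η s) P.μds := by
  obtain ⟨C, hC⟩ := exists_bound_deriv_smoothTransition
  refine η.integrable_smul (continuous_cutoffRise n) (C := n * C) fun s => ?_
  rw [cutoffRise, abs_mul, abs_mul, Nat.abs_cast]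
  refine (mul_le_of_le_one_right (by positivity) (abs_smoothTransition_le_one _)).trans ?_
  gcongr
  exact hC _

/-- Here the slope grows like n, and domination is not available. The support has measure of order
1/n, which only makes the integral bounded; it tends to zero because η does as s → 0. This is the
one place where the boundary condition in the domain of T enters. -/
theorem tendsto_integral_cutoffRise {η : Memory P} (h : VanishesAtZero η) :
    Tendsto (fun n => ∫ s, cutoffRise n s • η s ∂P.μds) atTop (𝓝 0) := by
  obtain ⟨F, -, hF, hF0⟩ := h
  obtain ⟨C, hC⟩ := exists_bound_deriv_smoothTransition
  have hC0 : 0 ≤ C := (abs_nonneg _).trans (hC 0)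
  have hK : 0 ≤ C * P.μ 0 * 2 := by have := P.μ_nonneg 0; positivity
  rw [Metric.tendsto_atTop']
  intro ε hε
  -- The final estimate is C μ(0) · 2 · e; the added 1 makes it strictly less than ε and keeps the
  -- denominator positive.
  set e : ℝ := ε / (C * P.μ 0 * 2 + 1) with he
  have he0 : 0 < e := by positivity
  obtain ⟨d, hd, hdF⟩ := (Metric.tendsto_nhdsWithin_nhds.mp hF0) e he0
  obtain ⟨N, hN⟩ := exists_nat_gt (2 / d)
  refine ⟨N, fun n hn => ?_⟩
  have hn0 : 0 < n := (Nat.zero_le _).trans_lt hn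
  have hn' : (0 : ℝ) < n := Nat.cast_pos.mpr hn0
  have h2n : 2 / (n : ℝ) < d := by
    rw [div_lt_iff₀ hn', mul_comm, ← div_lt_iff₀ hd]
    exact hN.trans (Nat.cast_lt.mpr hn)
  rw [dist_zero_right, ← setIntegral_eq_integral_of_forall_compl_eq_zero
    (s := Icc (0 : ℝ) (2 / n)) fun s hs => by rw [cutoffRise_eq_zero hn0 hs, zero_smul]]
  have hb := norm_setIntegral_le_of_norm_le_const_ae (μ := P.μds) (s := Icc (0 : ℝ) (2 / n))
    (f := fun s => cutoffRise n s • η s) (C := n * C * e) (measure_lt_top _ _) (by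
      rw [ae_restrict_iff' measurableSet_Icc]
      filter_upwards [hF, P.ae_μds_pos] with s hs hs0 hs1
      rw [norm_smul, cutoffRise, norm_mul, norm_mul, Real.norm_natCast, hs]
      have h3 := hdF (x := s) hs0 (by
        rw [dist_zero_right, Real.norm_of_nonneg hs0.le]
        exact hs1.2.trans_lt h2n)
      rw [dist_zero_right] at h3
      have h4 : (n : ℝ) * ‖deriv Real.smoothTransition (n * s - 1)‖ *
          ‖Real.smoothTransition (n - s)‖ ≤ n * C := by
        refine (mul_le_of_le_one_right (by positivity) (abs_smoothTransition_le_one _)).trans ?_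
        gcongr
        exact hC _
      gcongr)
  refine hb.trans_lt ?_
  calc n * C * e * P.μds.real (Icc 0 (2 / n)) ≤ n * C * e * (P.μ 0 * (2 / n)) := by
        gcongr
        exact P.μds_real_Icc_le (by positivity)
    _ = C * P.μ 0 * 2 * e := by field_simp
    _ < ε := by
        rw [he, mul_div_assoc', div_lt_iff₀ (by positivity)]
        nlinarith

theorem integral_sub_add_mul_smul {α E : Type*} [MeasurableSpace α] {ν : Measure α}
    [NormedAddCommGroup E] [NormedSpace ℝ E] {p r c : α → ℝ} {f : α → E}
    (hp : Integrable (fun s => p s • f s) ν) (hr : Integrable (fun s => r s • f s) ν)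
    (hc : Integrable (fun s => c s • f s) ν) (a : ℝ) :
    ∫ s, (p s - r s + a * c s) • f s ∂ν
      = (∫ s, p s • f s ∂ν) - (∫ s, r s • f s ∂ν) + a • ∫ s, c s • f s ∂ν := by
  simp only [add_smul, sub_smul, mul_smul]
  have h1 : Integrable (fun s => p s • f s - r s • f s) ν := hp.sub hr
  have h2 : Integrable (fun s => a • c s • f s) ν := hc.smul a
  rw [integral_add h1 h2, integral_sub hp hr, integral_smul]

/-- Integration by parts in the memory variable, without boundary terms. -/
theorem MemoryGenerator.integral_eq {η ξ : Memory P} (h : MemoryGenerator η ξ) :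
    ∫ s, ξ s ∂P.μds = -(P.β / P.τ) • ∫ s, η s ∂P.μds := by
  have key : ∀ n : ℕ, 0 < n → ∫ s, cutoff n s • ξ s ∂P.μds
      = (∫ s, cutoffRise n s • η s ∂P.μds) - (∫ s, cutoffFall n s • η s ∂P.μds)
        + -(P.β / P.τ) • ∫ s, cutoff n s • η s ∂P.μds := by
    intro n hn
    have hn' : (0 : ℝ) < n := Nat.cast_pos.mpr hn
    have hsupp : Function.support (fun s => P.μ s * cutoff n s) ⊆ Icc (1 / n : ℝ) n := by
      intro s hs
      by_contra hs'
      exact hs (by simp only [cutoff_eq_zero hn hs', mul_zero])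
    have hd : deriv (fun s => P.μ s * cutoff n s) = fun s => P.μ s *
        (cutoffRise n s - cutoffFall n s + -(P.β / P.τ) * cutoff n s) := by
      ext s
      refine ((P.hasDerivAt_μ s).mul (hasDerivAt_cutoff n s)).deriv.trans ?_
      ring
    -- The test function is μ times the cut-off, compactly supported in (0, ∞). Its derivative
    -- splits into the rise, the fall and the term from μ' = -(β/τ) μ; only the last survives as n →
    -- ∞.
    have hw := h.1 (fun s => P.μ s * cutoff n s) (P.contDiff_μ.mul (contDiff_cutoff n))
      (HasCompactSupport.of_support_subset_isCompact isCompact_Icc hsupp)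
      ((closure_minimal hsupp isClosed_Icc).trans fun s hs =>
        (one_div_pos.mpr hn').trans_le hs.1)
    rw [hd, P.setIntegral_μ_smul, P.setIntegral_μ_smul] at hw
    have e1 : ∫ s, cutoff n s • (-ξ : Memory P) s ∂P.μds = -∫ s, cutoff n s • ξ s ∂P.μds := by
      rw [← integral_neg]
      apply integral_congr_ae
      filter_upwards [Lp.coeFn_neg ξ] with s hs
      rw [hs, Pi.neg_apply, smul_neg]
    rw [e1, neg_neg] at hw
    have hc : Integrable (fun s => cutoff n s • η s) P.μds :=
      η.integrable_smul (contDiff_cutoff n).continuous (abs_cutoff_le_one n)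
    rw [← hw]
    exact integral_sub_add_mul_smul (integrable_cutoffRise η n) (integrable_cutoffFall η n) hc _
  have hlim := ((tendsto_integral_cutoffRise h.2).sub (tendsto_integral_cutoffFall η)).add
    ((tendsto_integral_cutoff η).const_smul (-(P.β / P.τ)))
  rw [sub_zero, zero_add] at hlim
  refine tendsto_nhds_unique (tendsto_integral_cutoff ξ) (hlim.congr' ?_)
  filter_upwards [eventually_gt_atTop 0] with n hn
  exact (key n hn).symm

/-! ### The map between the two phase spaces -/

/-- On a finite measure the L¹ norm is controlled by the L² norm, by Hölder. -/
theorem norm_integral_le_L2 {α E : Type*} [MeasurableSpace α] [NormedAddCommGroup E]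
    [NormedSpace ℝ E] (ν : Measure α) [IsFiniteMeasure ν] (f : Lp E 2 ν) :
    ‖∫ s, f s ∂ν‖ ≤ ν.real univ ^ (1 / 2 : ℝ) * ‖f‖ := by
  have h : ‖∫ s, f s ∂ν‖ₑ ≤ eLpNorm f 2 ν * ν univ ^ (1 / 2 : ℝ) := by
    refine (enorm_integral_le_lintegral_enorm _).trans ?_
    rw [← eLpNorm_one_eq_lintegral_enorm]
    refine (eLpNorm_le_eLpNorm_mul_rpow_measure_univ (q := 2) (by norm_num)
      (Lp.aestronglyMeasurable f)).trans_eq ?_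
    norm_num
  rw [← ofReal_measureReal, ENNReal.ofReal_rpow_of_nonneg measureReal_nonneg (by norm_num),
    ← Lp.enorm_def, ← ofReal_norm, ← ofReal_norm, ← ENNReal.ofReal_mul (norm_nonneg _),
    ENNReal.ofReal_le_ofReal_iff (by positivity)] at h
  linarith

/-- Integration as a bounded operator on `L²` of a finite measure. -/
noncomputable def integralL2 {α E : Type*} [MeasurableSpace α] [NormedAddCommGroup E]
    [NormedSpace ℝ E] (ν : Measure α) [IsFiniteMeasure ν] : Lp E 2 ν →L[ℝ] E :=
  LinearMap.mkContinuous
    { toFun := fun f => ∫ s, f s ∂ν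
      map_add' := fun f g => by
        rw [← integral_add ((Lp.memLp f).integrable (by norm_num))
          ((Lp.memLp g).integrable (by norm_num))]
        exact integral_congr_ae (Lp.coeFn_add f g)
      map_smul' := fun c f => by
        rw [RingHom.id_apply, ← integral_smul]
        exact integral_congr_ae (Lp.coeFn_smul c f) }
    (ν.real univ ^ (1 / 2 : ℝ)) (norm_integral_le_L2 ν)

/-- The derivative as a bounded operator on `H₀¹`. -/
noncomputable def H10.gradL (ℓ : ℝ) : H10 ℓ →L[ℝ] L2 ℓ :=
  H10.grad.mkContinuous 1 fun f => by rw [one_mul, H10.norm_eq]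

/-- The heat flux `-(1/β) ∫ μ(s) η_x(s) ds` of a memory variable. -/
noncomputable def heatFlux (P : Params) : Memory P →L[ℝ] L2 P.ℓ :=
  -(1 / P.β) • (H10.gradL P.ℓ).comp (integralL2 P.μds)

theorem heatFlux_apply (η : Memory P) :
    heatFlux P η = -(1 / P.β) • H10.grad (∫ s, η s ∂P.μds) := rfl

/-- The state with mechanical and thermal part `u` and memory `η`. -/
def GPSpace.mk (u : Mech P) (η : Memory P) : GPSpace P := (u, η)

/-- The state with mechanical and thermal part `u` and heat flux `q`. -/
def TCSpace.mk (u : Mech P) (q : L2 P.ℓ) : TCSpace P := (u, q)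

theorem GPSpace.norm_mk_sq (u : Mech P) (η : Memory P) :
    ‖GPSpace.mk u η‖ ^ 2 = ‖u‖ ^ 2 + 1 / P.β * ‖η‖ ^ 2 := GPSpace.norm_sq _

theorem TCSpace.norm_mk_sq (u : Mech P) (q : L2 P.ℓ) :
    ‖TCSpace.mk u q‖ ^ 2 = ‖u‖ ^ 2 + P.τ * ‖q‖ ^ 2 := TCSpace.norm_sq _

theorem GPSpace.norm_fst_le (z : GPSpace P) : ‖z.1‖ ≤ ‖z‖ := by
  refine le_of_sq_le_sq ?_ (norm_nonneg _)
  rw [z.norm_sq]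
  have := P.β_pos
  exact le_add_of_nonneg_right (by positivity)

theorem GPSpace.norm_snd_le (z : GPSpace P) : ‖z.2‖ ≤ √P.β * ‖z‖ := by
  refine le_of_sq_le_sq ?_ (by positivity)
  rw [mul_pow, Real.sq_sqrt P.β_pos.le, z.norm_sq, mul_add, ← mul_assoc,
    mul_one_div_cancel P.β_pos.ne', one_mul]
  have := P.β_pos
  exact le_add_of_nonneg_left (by positivity)

theorem TCSpace.norm_mk_le (u : Mech P) (q : L2 P.ℓ) : ‖TCSpace.mk u q‖ ≤ ‖u‖ + √P.τ * ‖q‖ := by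
  refine le_of_sq_le_sq ?_ (by positivity)
  rw [TCSpace.norm_mk_sq, add_sq, mul_pow, Real.sq_sqrt P.τ_pos.le]
  have : 0 ≤ 2 * ‖u‖ * (√P.τ * ‖q‖) := by positivity
  linarith

theorem TCSpace.mk_add (u v : Mech P) (p q : L2 P.ℓ) :
    TCSpace.mk (u + v) (p + q) = TCSpace.mk u p + TCSpace.mk v q := rfl

theorem TCSpace.mk_smul (c : ℝ) (u : Mech P) (q : L2 P.ℓ) :
    TCSpace.mk (c • u) (c • q) = c • TCSpace.mk u q := rfl

/-- The projection of `H` onto the mechanical and thermal part. -/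
noncomputable def GPSpace.fstL (P : Params) : GPSpace P →L[ℝ] Mech P :=
  LinearMap.mkContinuous
    { toFun := fun z => z.1
      map_add' := fun _ _ => rfl
      map_smul' := fun _ _ => rfl }
    1 fun z => by rw [one_mul]; exact z.norm_fst_le

/-- The projection of `H` onto the memory. -/
noncomputable def GPSpace.sndL (P : Params) : GPSpace P →L[ℝ] Memory P :=
  LinearMap.mkContinuous
    { toFun := fun z => z.2
      map_add' := fun _ _ => rfl
      map_smul' := fun _ _ => rfl }
    (√P.β) fun z => z.norm_snd_le

/-- The inclusion of the mechanical and thermal part into `Ĥ`. -/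
noncomputable def TCSpace.inl (P : Params) : Mech P →L[ℝ] TCSpace P :=
  LinearMap.mkContinuous
    { toFun := fun u => TCSpace.mk u 0
      map_add' := fun u v => by rw [← TCSpace.mk_add, add_zero]
      map_smul' := fun c u => by rw [RingHom.id_apply, ← TCSpace.mk_smul, smul_zero] }
    1 fun u => by
      refine (TCSpace.norm_mk_le u 0).trans_eq ?_
      rw [norm_zero, mul_zero, add_zero, one_mul]

/-- The inclusion of the heat flux into `Ĥ`. -/
noncomputable def TCSpace.inr (P : Params) : L2 P.ℓ →L[ℝ] TCSpace P :=
  LinearMap.mkContinuous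
    { toFun := fun q => TCSpace.mk 0 q
      map_add' := fun u v => by rw [← TCSpace.mk_add, add_zero]
      map_smul' := fun c u => by rw [RingHom.id_apply, ← TCSpace.mk_smul, smul_zero] }
    (√P.τ) fun q => by
      refine (TCSpace.norm_mk_le 0 q).trans_eq ?_
      rw [norm_zero, zero_add]

theorem TCSpace.inl_add_inr (u : Mech P) (q : L2 P.ℓ) :
    TCSpace.inl P u + TCSpace.inr P q = TCSpace.mk u q := by
  change TCSpace.mk u 0 + TCSpace.mk 0 q = TCSpace.mk u q
  rw [← TCSpace.mk_add, add_zero, zero_add]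

/-- The bounded map `(u, η) ↦ (u, -(1/β) ∫ μ(s) η_x(s) ds)`, which sends the memory variable to
the heat flux. -/
noncomputable def toCattaneo (P : Params) : GPSpace P →L[ℝ] TCSpace P :=
  (TCSpace.inl P).comp (GPSpace.fstL P)
    + (TCSpace.inr P).comp ((heatFlux P).comp (GPSpace.sndL P))

theorem toCattaneo_mk (u : Mech P) (η : Memory P) : toCattaneo P (GPSpace.mk u η)
    = TCSpace.mk u (heatFlux P η) := by
  rw [toCattaneo, _root_.add_apply, ContinuousLinearMap.comp_apply,
    ContinuousLinearMap.comp_apply, ContinuousLinearMap.comp_apply]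
  exact TCSpace.inl_add_inr u (heatFlux P η)

/-- The image under the heat flux map of the memory equation. -/
theorem MemoryGenerator.heatFlux_add {η Tη ξ : Memory P} {ϑ : H10 P.ℓ}
    (h : MemoryGenerator η Tη) (hξ : ξ =ᵐ[P.μds] fun s => Tη s + ϑ) :
    heatFlux P ξ = -(P.β / P.τ) • heatFlux P η - (1 / P.τ) • ϑ.grad := by
  have hβ := P.β_pos.ne'
  have hτ := P.τ_pos.ne'
  have e : ∫ s, ξ s ∂P.μds = -(P.β / P.τ) • ∫ s, η s ∂P.μds + (P.β / P.τ) • ϑ := by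
    rw [integral_congr_ae hξ, integral_add (Memory.integrable Tη) (integrable_const _),
      integral_const, P.μds_real_univ, h.integral_eq]
  rw [heatFlux_apply, heatFlux_apply, e, map_add, map_smul, map_smul]
  generalize H10.grad (∫ s, η s ∂P.μds) = y
  rw [smul_add, smul_comm, sub_eq_add_neg, smul_smul (-(1 / P.β)), ← neg_smul]
  congr 2
  field_simp

/-- The map to the Cattaneo variables intertwines the two generators. -/
theorem GPGenerator.toCattaneo {u v : Mech P} {η ξ : Memory P}
    (h : GPGenerator (GPSpace.mk u η) (GPSpace.mk v ξ)) :
    TCGenerator (TCSpace.mk u (heatFlux P η)) (TCSpace.mk v (heatFlux P ξ)) := by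
  obtain ⟨ϑ, Tη, Yxx, h1, h2, h3, h4, h5⟩ := h
  -- The domain condition that ∫ μ η is in H² becomes q ∈ H¹, with q_x = -(1/β) times its second
  -- derivative; the mechanical rows carry over unchanged.
  have hY : HasWeakDeriv (heatFlux P η) (-(1 / P.β) • Yxx) := h3.smul _
  have e : (1 / (P.β * P.ρ₃)) • Yxx = -(1 / P.ρ₃) • -(1 / P.β) • Yxx := by
    rw [smul_smul]
    congr 1
    field_simp
  rw [e] at h4
  exact ⟨ϑ, -(1 / P.β) • Yxx, h1, hY, h4, h2.heatFlux_add h5⟩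

/-- States with zero-mean heat flux come isometrically from states with constant memory. -/
theorem exists_toCattaneo_eq (u : Mech P) {q : L2 P.ℓ} (hq : ZeroMean q) :
    ∃ z : GPSpace P, toCattaneo P z = TCSpace.mk u q ∧ ‖z‖ ≤ ‖TCSpace.mk u q‖ := by
  have hβ := P.β_pos
  have hτ := P.τ_pos
  -- The constant memory h has h_x = -τ q: integration multiplies by the mass β/τ, and the factor
  -- -1/β then returns q. In the norm, (1/β)(β/τ) τ² = τ, the weight of the flux.
  obtain ⟨h, hh⟩ := H10.exists_grad_eq P.ℓ_pos.le (hq.smul (-P.τ))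
  refine ⟨GPSpace.mk u (Lp.const 2 P.μds h), ?_, ?_⟩
  · have e : -(1 / P.β) * (P.β / P.τ) * -P.τ = 1 := by field_simp
    rw [toCattaneo_mk, heatFlux_apply, integral_congr_ae (Lp.coeFn_const 2 P.μds h)]
    simp only [Function.const_apply]
    rw [integral_const, P.μds_real_univ, map_smul, hh, smul_smul, smul_smul, e, one_smul]
  · refine le_of_sq_le_sq ?_ (norm_nonneg _)
    rw [GPSpace.norm_mk_sq, TCSpace.norm_mk_sq]
    have hn : ‖Lp.const 2 P.μds h‖ ^ 2 ≤ (P.β / P.τ) * (P.τ * ‖q‖) ^ 2 := by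
      have h1 := Lp.norm_const_le 2 P.μds h
      rw [H10.norm_eq, hh, norm_smul, norm_neg, Real.norm_of_nonneg hτ.le, P.μds_real_univ,
        ENNReal.toReal_ofNat, ← Real.sqrt_eq_rpow] at h1
      refine (pow_le_pow_left₀ (norm_nonneg _) h1 2).trans_eq ?_
      rw [mul_pow, Real.sq_sqrt (by positivity), mul_comm]
    calc ‖u‖ ^ 2 + 1 / P.β * ‖Lp.const 2 P.μds h‖ ^ 2
        ≤ ‖u‖ ^ 2 + 1 / P.β * ((P.β / P.τ) * (P.τ * ‖q‖) ^ 2) := by gcongr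
      _ = ‖u‖ ^ 2 + P.τ * ‖q‖ ^ 2 := by field_simp

/-- Constant heat fluxes are eigenvectors of the Cattaneo operator. -/
theorem TCGenerator.const (P : Params) (c : ℝ) :
    TCGenerator (TCSpace.mk 0 (c • L2.one P.ℓ))
      (-(P.β / P.τ) • TCSpace.mk 0 (c • L2.one P.ℓ)) := by
  have e : -(P.β / P.τ) • TCSpace.mk (P := P) 0 (c • L2.one P.ℓ)
      = TCSpace.mk 0 (-(P.β / P.τ) • c • L2.one P.ℓ) := Prod.ext (smul_zero _) rfl
  rw [e]
  refine ⟨0, 0, ⟨0, 0, ?_, ?_, ?_, ?_, ?_, ?_, ?_⟩, ?_, ?_, ?_⟩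
  · exact HasWeakDeriv.zero
  · exact (map_zero H10.val).trans (map_zero H1s.grad).symm
  · exact map_zero H10.val
  · exact map_zero H10.val
  · change (0 : L2 P.ℓ) = _ • (0 + H1s.grad 0)
    rw [map_zero, add_zero, smul_zero]
  · exact map_zero H1s.val
  · change (0 : L2 P.ℓ) = _ • H10.grad 0 - _ • (H10.grad 0 + H1s.val 0) - _ • H10.grad 0
    simp only [map_zero, add_zero, smul_zero, sub_zero]
  · have h := (HasWeakDeriv.one (ℓ := P.ℓ)).smul c
    rwa [smul_zero] at h
  · change (0 : L2 P.ℓ) = _ • 0 - _ • H1s.grad 0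
    simp only [map_zero, smul_zero, sub_zero]
  · change -(P.β / P.τ) • c • L2.one P.ℓ = -(P.β / P.τ) • c • L2.one P.ℓ - _ • H10.grad 0
    simp only [map_zero, smul_zero, sub_zero]

end Timoshenko

/-! ### Splitting off the mean of the flux -/

open Timoshenko in
theorem mainTheorem4 (P : Timoshenko.Params)
    (S : ℝ≥0 → Timoshenko.GPSpace P →L[ℝ] Timoshenko.GPSpace P)
    (hS : Timoshenko.IsSemigroupGeneratedBy S Timoshenko.GPGenerator)
    (S' : ℝ≥0 → Timoshenko.TCSpace P →L[ℝ] Timoshenko.TCSpace P)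
    (hS' : Timoshenko.IsSemigroupGeneratedBy S' Timoshenko.TCGenerator)
    (h : Timoshenko.IsExpStable S) : Timoshenko.IsExpStable S' := by
  obtain ⟨r, hr, C, hC, hb⟩ := h
  have hβτ := div_pos P.β_pos P.τ_pos
  have hrate : 0 < min r (P.β / P.τ) := lt_min hr hβτ
  set L := toCattaneo P
  -- The 2 comes from ‖y‖ ≤ ‖z - k‖ ≤ ‖z‖ + ‖k‖ ≤ 2‖z‖. The 1 is the contribution of the constant
  -- flux k, and it also makes the constant at least 1.
  refine ⟨min r (P.β / P.τ), hrate, 2 * ‖L‖ * C + 1, ?_, fun t z => ?_⟩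
  · have : 0 ≤ 2 * ‖L‖ * C := by positivity
    linarith
  obtain ⟨c, hc, hcn⟩ := L2.exists_mean z.2
  set k : TCSpace P := TCSpace.mk 0 (c • L2.one P.ℓ)
  have hz : z = TCSpace.mk z.1 (z.2 - c • L2.one P.ℓ) + k :=
    Prod.ext (add_zero _).symm (sub_add_cancel _ _).symm
  have hk : ‖k‖ ≤ ‖z‖ := by
    refine le_of_sq_le_sq ?_ (norm_nonneg _)
    rw [TCSpace.norm_mk_sq, TCSpace.norm_sq]
    have := P.τ_pos
    rw [norm_zero]
    gcongr
    positivity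
  -- Only the zero-mean part of z is lifted to the Gurtin–Pipkin space, where the assumed decay is
  -- available.
  obtain ⟨y, hy, hyn⟩ := exists_toCattaneo_eq z.1 hc
  have hyz : ‖y‖ ≤ 2 * ‖z‖ := by
    have := norm_sub_le z k
    nth_rewrite 1 [hz] at this
    rw [add_sub_cancel_right] at this
    linarith
  have hint : L (S t y) = S' t (L y) :=
    hS.semigroup.intertwine hS'.semigroup L
      (fun z w hzw => by
        have h1 : GPGenerator (GPSpace.mk z.1 z.2) (GPSpace.mk w.1 w.2) :=
          (hS.generator _ _).mpr hzw
        have h2 := h1.toCattaneo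
        rw [← toCattaneo_mk, ← toCattaneo_mk] at h2
        exact (hS'.generator _ _).mp h2) t y
  have hconst : S' t k = Real.exp (-(P.β / P.τ) * t) • k :=
    hS'.semigroup.apply_eigenvector ((hS'.generator _ _).mp (TCGenerator.const P c)) t
  calc ‖S' t z‖ = ‖L (S t y) + Real.exp (-(P.β / P.τ) * t) • k‖ := by
        rw [hint, hy, ← hconst, ← map_add, ← hz]
    _ ≤ ‖L‖ * (C * Real.exp (-r * t) * ‖y‖) + Real.exp (-(P.β / P.τ) * t) * ‖k‖ := by
        refine (norm_add_le _ _).trans (add_le_add ?_ ?_)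
        · exact (L.le_opNorm _).trans (mul_le_mul_of_nonneg_left (hb t y) (norm_nonneg _))
        · rw [norm_smul, Real.norm_of_nonneg (Real.exp_pos _).le]
    _ ≤ ‖L‖ * (C * Real.exp (-min r (P.β / P.τ) * t) * (2 * ‖z‖))
        + Real.exp (-min r (P.β / P.τ) * t) * ‖z‖ := by
        gcongr
        · exact min_le_left _ _
        · exact min_le_right _ _
    _ = (2 * ‖L‖ * C + 1) * Real.exp (-min r (P.β / P.τ) * t) * ‖z‖ := by ring
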